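/- Let $M$ and $\mathfrak G$ be smooth (Hausdorff, finite-dimensional) manifolds, $m=\dim M$. A *group bundle* $\pi\colon\mathfrak G\to M$ is a smooth (locally trivial) fibre bundle, with $\pi$ a submersion, together with smooth maps $\mathfrak m\colon\mathfrak G\times_M\mathfrak G\to\mathfrak G$ (written $(g,h)\mapsto gh$), $\mathfrak i\colon\mathfrak G\to\mathfrak G$ (written $g\mapsto g^{-1}$) and $\mathfrak e\colon M\to\mathfrak G$ over $M$ which make every fibre $\mathfrak G_x=\pi^{-1}(x)$ a (Lie) group. For an open set $U\subseteq M$ and a point $x\in M$, a *group bundle trivialization* of $\mathfrak G|_U=\pi^{-1}(U)$ with fibre $\mathfrak G_x$ is a diffeomorphism $\phi\colon\mathfrak G|_U\to U\times\mathfrak G_x$ over $U$ which restricts to a Lie group isomorphism $\mathfrak G_y\to\{y\}\times\mathfrak G_x$ for every $y\in U$. The group bundle is *locally trivial as a group bundle* if every $x\in M$ has an open neighbourhood $U$ for which such a trivialization, with fibre $\mathfrak G_x$, exists. A *connection* in $\pi$ is a smooth distribution $\mathcal H$ on $\mathfrak G$ with $T_g\mathfrak G=\mathcal H_g\oplus\ker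 \mathrm d_g\pi$ for all $g$. It is a *group connection* if for all $(g,h)\in\mathfrak G\times_M\mathfrak G$, with $x=\pi(g)=\pi(h)$, $$\mathrm d_{(g,h)}\mathfrak m(\mathcal H_g\times_{T_xM}\mathcal H_h)=\mathcal H_{gh},\qquad \mathrm d_g\mathfrak i(\mathcal H_g)=\mathcal H_{g^{-1}}.$$ The horizontal lift $\tilde X$ of a vector field $X$ on an open set $U\subseteq M$ is the vector field on $\mathfrak G|_U$ with $\tilde X_g\in\mathcal H_g$ and $\mathrm d_g\pi(\tilde X_g)=X_{\pi(g)}$. Write $\exp(tY)g$ for the value at time $t$ of the integral curve of $Y$ that starts at $g$, if it is defined up to time $t$. **Theorem.** Let $\pi\colon\mathfrak G\to M$ be a group bundle that admits a group connection $\mathcal H$. Then it is locally trivial as a group bundle. More precisely, let $p\in M$ and let $\lambda=(\lambda_1,\dots,\lambda_m)$ be smooth coordinates on an open neighbourhood $\mathcal U$ of $p$ with $\lambda(p)=0$ and $\lambda(\mathcal U)=\left(-\tfrac12,\tfrac12\right)^m$. Let $\tilde X_i$ be the horizontal lift to $\mathfrak G|_{\mathcal U}$ of $X_i=\partial/\partial\lambda_i$.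 Then for every $g\in\mathfrak G|_{\mathcal U}$ all the flows in the following formula are defined (within $\mathfrak G|_{\mathcal U}$), and $$\psi\colon\mathfrak G|_{\mathcal U}\to\mathcal U\times\mathfrak G_p,\qquad \psi(g)=\Bigl(\pi(g),\ \exp\bigl(-\lambda_m(\pi(g))\tilde X_m\bigr)\cdots\exp\bigl(-\lambda_1(\pi(g))\tilde X_1\bigr)\,g\Bigr)$$ is a group bundle trivialization of $\mathfrak G|_{\mathcal U}$ with fibre $\mathfrak G_p$. -/

import Mathlib

open Set
open scoped Manifold ContDiff

noncomputable section

namespace GroupBundles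

/- Throughout, `M` and `G` carry smooth structures modelled on `ℝ^m` and `ℝ^N`.  Fibres
`π ⁻¹' {x}` of a submersion and the fibre product `G ×_M G` are embedded submanifolds; a map from
(or into) an embedded submanifold is smooth exactly when it is `ContMDiffOn` that subset (or smooth
into the ambient manifold).  Smoothness on these submanifolds is therefore expressed by `ContMDiffOn`
of a map that is defined on the ambient manifold and whose values off the subset play no role. -/

variable {m N : ℕ} {M G : Type*}
  [TopologicalSpace M] [ChartedSpace (EuclideanSpace ℝ (Fin m)) M]
  [TopologicalSpace G] [ChartedSpace (EuclideanSpace ℝ (Fin N)) G]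
  [IsManifold (𝓡 N) ∞ G]

variable (m N) in
/-- `Φ` restricts to a fibre preserving diffeomorphism from `π⁻¹(U)` onto `U × π⁻¹(x)`, with
inverse `Ψ`. -/
structure IsFiberTrivialization (π : G → M) (x : M) (U : Set M)
    (Φ : G → M × G) (Ψ : M × G → G) : Prop where
  mapsTo : MapsTo Φ (π ⁻¹' U) (U ×ˢ (π ⁻¹' {x}))
  mapsTo_inv : MapsTo Ψ (U ×ˢ (π ⁻¹' {x})) (π ⁻¹' U)
  invOn : InvOn Ψ Φ (π ⁻¹' U) (U ×ˢ (π ⁻¹' {x}))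
  smooth : ContMDiffOn (𝓡 N) ((𝓡 m).prod (𝓡 N)) ∞ Φ (π ⁻¹' U)
  smooth_inv : ContMDiffOn ((𝓡 m).prod (𝓡 N)) (𝓡 N) ∞ Ψ (U ×ˢ (π ⁻¹' {x}))
  fiber_preserving : ∀ g ∈ π ⁻¹' U, (Φ g).1 = π g

variable (m N) in
/-- A smooth (locally trivial) fibre bundle, without any group structure. -/
def IsSmoothFiberBundle (π : G → M) : Prop :=
  ∀ x : M, ∃ U : Set M, IsOpen U ∧ x ∈ U ∧
    ∃ (Φ : G → M × G) (Ψ : M × G → G), IsFiberTrivialization m N π x U Φ Ψ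

/-- The fibre product `G ×_M G`. -/
def fiberProduct (π : G → M) : Set (G × G) := {p | π p.1 = π p.2}

variable (m N) in
/-- A group bundle `π : G → M`: a smooth bundle, which is a Lie groupoid whose source and target
are both `π`.  The values of `mul` off the fibre product are irrelevant. -/
structure GroupBundle (π : G → M) where
  mul : G → G → G
  inv : G → G
  one : M → G
  proj_mul : ∀ g h, π g = π h → π (mul g h) = π g
  proj_inv : ∀ g, π (inv g) = π g
  proj_one : ∀ x, π (one x) = x
  mul_assoc : ∀ g h k, π g = π h → π h = π k → mul (mul g h) k = mul g (mul h k)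
  one_mul : ∀ g, mul (one (π g)) g = g
  mul_one : ∀ g, mul g (one (π g)) = g
  inv_mul : ∀ g, mul (inv g) g = one (π g)
  mul_inv : ∀ g, mul g (inv g) = one (π g)
  smooth_proj : ContMDiff (𝓡 N) (𝓡 m) ∞ π
  submersion : ∀ g, Function.Surjective (mfderiv (𝓡 N) (𝓡 m) π g)
  smooth_mul : ContMDiffOn ((𝓡 N).prod (𝓡 N)) (𝓡 N) ∞ (fun p : G × G => mul p.1 p.2)
    (fiberProduct π)
  smooth_inv : ContMDiff (𝓡 N) (𝓡 N) ∞ inv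
  smooth_one : ContMDiff (𝓡 m) (𝓡 N) ∞ one
  smooth_bundle : IsSmoothFiberBundle m N π

variable {π : G → M}

/-- A trivialization over `U` with model fibre the group `π⁻¹(x)`, in the sense of group bundles:
a fibre preserving diffeomorphism `π⁻¹(U) → U × π⁻¹(x)` that is a group homomorphism (hence a Lie
group isomorphism) on each fibre over `U`. -/
structure IsGroupTrivialization (B : GroupBundle m N π) (x : M) (U : Set M)
    (Φ : G → M × G) (Ψ : M × G → G) : Prop
    extends IsFiberTrivialization m N π x U Φ Ψ where
  map_mul : ∀ g h, π g ∈ U → π g = π h → (Φ (B.mul g h)).2 = B.mul (Φ g).2 (Φ h).2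

/-- Local triviality in the sense of group bundles. -/
def IsLocallyTrivial (B : GroupBundle m N π) : Prop :=
  ∀ x : M, ∃ U : Set M, IsOpen U ∧ x ∈ U ∧
    ∃ (Φ : G → M × G) (Ψ : M × G → G), IsGroupTrivialization B x U Φ Ψ

variable (m N) in
/-- A connection for `π`: a smooth distribution of subspaces of `TG` complementary to the vertical
subspaces `ker dπ`.  Smoothness means that the distribution has smooth local frames. -/
structure IsConnection (π : G → M) (H : ∀ g : G, Submodule ℝ (TangentSpace (𝓡 N) g)) : Prop where
  horizontal : ∀ g, IsCompl (H g) (LinearMap.ker (mfderiv (𝓡 N) (𝓡 m) π g).toLinearMap)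
  smooth : ∀ g₀ : G, ∃ V : Set G, IsOpen V ∧ g₀ ∈ V ∧
    ∃ Y : Fin m → ∀ g : G, TangentSpace (𝓡 N) g,
      (∀ i, ContMDiffOn (𝓡 N) (𝓡 N).tangent ∞
        (fun g => (⟨g, Y i g⟩ : TangentBundle (𝓡 N) G)) V) ∧
      ∀ g ∈ V, H g = Submodule.span ℝ (range fun i => Y i g)

/-- The differential at `(g, h)` of the multiplication `G ×_M G → G`.  It is only meaningful on
`T_(g,h) (G ×_M G) = {(v, w) | dπ v = dπ w}`, where it is determined by the values of `mul` on
the fibre product. -/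
def dMul (B : GroupBundle m N π) (g h : G) :
    TangentSpace (𝓡 N) g × TangentSpace (𝓡 N) h → TangentSpace (𝓡 N) (B.mul g h) :=
  fun v => mfderivWithin ((𝓡 N).prod (𝓡 N)) (𝓡 N) (fun p : G × G => B.mul p.1 p.2)
    (fiberProduct π) (g, h) v

/-- A group connection: a connection that is compatible with multiplication and inversion. -/
structure IsGroupConnection (B : GroupBundle m N π)
    (H : ∀ g : G, Submodule ℝ (TangentSpace (𝓡 N) g)) : Prop
    extends IsConnection m N π H where
  map_mul : ∀ g h, π g = π h →
    dMul B g h '' {v | v.1 ∈ H g ∧ v.2 ∈ H h ∧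
      (mfderiv (𝓡 N) (𝓡 m) π g v.1 : EuclideanSpace ℝ (Fin m)) = mfderiv (𝓡 N) (𝓡 m) π h v.2}
      = (H (B.mul g h) : Set (TangentSpace (𝓡 N) (B.mul g h)))
  map_inv : ∀ g, (H g).map (mfderiv (𝓡 N) (𝓡 N) B.inv g).toLinearMap = H (B.inv g)

/-- The horizontal lift of a vector field `X` on `M`: at `g`, the unique `v ∈ H g` with
`dπ v = X (π g)`. -/
def horizontalLift (π : G → M) (H : ∀ g : G, Submodule ℝ (TangentSpace (𝓡 N) g))
    (X : ∀ q : M, TangentSpace (𝓡 m) q) (g : G) : TangentSpace (𝓡 N) g :=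
  Classical.epsilon fun v : TangentSpace (𝓡 N) g =>
    v ∈ H g ∧ mfderiv (𝓡 N) (𝓡 m) π g v = X (π g)

theorem horizontalLift_spec (B : GroupBundle m N π)
    {H : ∀ g : G, Submodule ℝ (TangentSpace (𝓡 N) g)} (hH : IsConnection m N π H)
    (X : ∀ q : M, TangentSpace (𝓡 m) q) (g : G) :
    horizontalLift π H X g ∈ H g ∧
      mfderiv (𝓡 N) (𝓡 m) π g (horizontalLift π H X g) = X (π g) := by
  refine Classical.epsilon_spec
    (p := fun v : TangentSpace (𝓡 N) g => v ∈ H g ∧ mfderiv (𝓡 N) (𝓡 m) π g v = X (π g)) ?_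
  obtain ⟨u, hu⟩ := B.submersion g (X (π g))
  have htop : u ∈ H g ⊔ LinearMap.ker (mfderiv (𝓡 N) (𝓡 m) π g).toLinearMap := by
    rw [(hH.horizontal g).sup_eq_top]; trivial
  obtain ⟨v, hv, w, hw, hvw⟩ := Submodule.mem_sup.1 htop
  refine ⟨v, hv, ?_⟩
  have hw' : mfderiv (𝓡 N) (𝓡 m) π g w = 0 := hw
  rw [← hu, ← hvw, map_add, hw', add_zero]

theorem horizontalLift_unique (B : GroupBundle m N π)
    {H : ∀ g : G, Submodule ℝ (TangentSpace (𝓡 N) g)} (hH : IsConnection m N π H)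
    (X : ∀ q : M, TangentSpace (𝓡 m) q) (g : G) (v : TangentSpace (𝓡 N) g) (hv : v ∈ H g)
    (hvX : mfderiv (𝓡 N) (𝓡 m) π g v = X (π g)) : v = horizontalLift π H X g := by
  obtain ⟨h1, h2⟩ := horizontalLift_spec B hH X g
  have hker : v - horizontalLift π H X g ∈
      LinearMap.ker (mfderiv (𝓡 N) (𝓡 m) π g).toLinearMap := by
    change mfderiv (𝓡 N) (𝓡 m) π g (v - horizontalLift π H X g) = 0
    rw [map_sub, hvX, h2, sub_self]
  exact sub_eq_zero.1
    (Submodule.disjoint_def.1 (hH.horizontal g).disjoint _ (sub_mem hv h1) hker)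

/-- `c` is a smooth coordinate system centred at `p` whose image is the open cube
`(-1/2, 1/2)^m`. -/
def IsCubeChart (p : M) (c : OpenPartialHomeomorph M (EuclideanSpace ℝ (Fin m))) : Prop :=
  c ∈ IsManifold.maximalAtlas (𝓡 m) ∞ M ∧ p ∈ c.source ∧ c p = 0 ∧
    c.target = {v | ∀ i, v i ∈ Ioo (-(1 / 2) : ℝ) (1 / 2)}

/-- The coordinate vector field `∂/∂c_i`, meaningful on `c.source`. -/
def coordField (c : OpenPartialHomeomorph M (EuclideanSpace ℝ (Fin m))) (i : Fin m) (q : M) :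
    TangentSpace (𝓡 m) q :=
  mfderiv (𝓡 m) (𝓡 m) c.symm (c q) (EuclideanSpace.single i (1 : ℝ))

/-- `exp (t Y) g` is defined and equal to `g'`, for the vector field `Y` on the open set `W`:
there is an integral curve of `Y` in `W`, on an open interval containing `0` and `t`, from `g` at
time `0` to `g'` at time `t`. -/
def FlowsTo (Y : ∀ g : G, TangentSpace (𝓡 N) g) (W : Set G) (t : ℝ) (g g' : G) : Prop :=
  ∃ (γ : ℝ → G) (a b : ℝ), 0 ∈ Ioo a b ∧ t ∈ Ioo a b ∧ MapsTo γ (Ioo a b) W ∧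
    IsMIntegralCurveOn γ Y (Ioo a b) ∧ γ 0 = g ∧ γ t = g'

/-- `exp (-c_m(π g) Y_m) ⋯ exp (-c_1(π g) Y_1) g` is defined and equal to `g'`, where `Y_i` is the
horizontal lift to `π⁻¹(c.source)` of the coordinate vector field `∂/∂c_i` (the flow of `Y_1` is
applied first). -/
def CubeFlowsTo (π : G → M) (H : ∀ g : G, Submodule ℝ (TangentSpace (𝓡 N) g))
    (c : OpenPartialHomeomorph M (EuclideanSpace ℝ (Fin m))) (g g' : G) : Prop :=
  ∃ z : Fin (m + 1) → G, z 0 = g ∧ z (Fin.last m) = g' ∧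
    ∀ i : Fin m, FlowsTo (horizontalLift π H (coordField c i)) (π ⁻¹' c.source)
      (-(c (π g) i)) (z i.castSucc) (z i.succ)

end GroupBundles

end

/-! A group connection makes horizontal transport multiplicative. Two integral curves of the lift of
a coordinate field that start in one fibre project to the same base curve. The differential of the
multiplication takes pairs of horizontal vectors over one base vector to horizontal vectors, so the
product of the two curves is again an integral curve (`LiftFlowsTo.mul`).

The heart of the matter is completeness over the cube (`exists_liftFlowsTo`). In a general bundle a
horizontal curve may leave every compact set before its projection ends. Here, elements close to the
unit section over a neighbourhood of a base point flow for a uniform time. Since `h = g (g⁻¹ h)`, an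
`h` near `g` in the same fibre flows for a given short time exactly when `g` does, so this property
is constant on connected subsets of a fibre (`eventually_exists_flow_of_isPreconnected`). Fibres may
have many components, so one element that flows is needed in the right component. It is found by
flowing backwards from the limit fibre, the component being singled out by an ordinary bundle
trivialization (`exists_liftFlowsTo_of_forall_lt`). A supremum argument finishes completeness.

The flow of the `i`-th lift translates the `i`-th coordinate and fixes the others. Hence `m` flows
carry every fibre over the cube to the fibre over the centre, the reversed flows give the inverse,
and multiplicativity gives homomorphisms. Smoothness of both maps rests on joint smoothness of flows
in point and time: locally this is the inverse function theorem for the Picard integral equation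
(`exists_contDiffOn_flow`), and the flow law spreads it over the whole domain
(`contMDiffOn_of_flowsTo`). -/

noncomputable section

open Metric Filter Topology

namespace SmoothFlow

universe u

/-! ### Smoothness of superposition operators on spaces of continuous maps -/

section Superposition

variable {K : Type*} [TopologicalSpace K] [CompactSpace K]
  {E F : Type*} [NormedAddCommGroup E] [NormedSpace ℝ E] [NormedAddCommGroup F] [NormedSpace ℝ F]

variable (K E F) in
/-- Pointwise application of a continuous family of operators to a continuous map. -/
def pointwiseApply : C(K, E →L[ℝ] F) →L[ℝ] C(K, E) →L[ℝ] C(K, F) :=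
  LinearMap.mkContinuous₂
    (LinearMap.mk₂ ℝ (fun (A : C(K, E →L[ℝ] F)) (u : C(K, E)) =>
        (⟨fun k => A k (u k), A.continuous.clm_apply u.continuous⟩ : C(K, F)))
      (fun _ _ _ => by ext; simp) (fun _ _ _ => by ext; simp)
      (fun _ _ _ => by ext; simp) (fun _ _ _ => by ext; simp)) 1
    (fun A u => by
      rw [ContinuousMap.norm_le _ (by positivity)]
      intro k
      simp only [LinearMap.mk₂_apply, ContinuousMap.coe_mk, one_mul]
      exact (A k).le_of_opNorm_le_of_le (A.norm_coe_le_norm k) (u.norm_coe_le_norm k))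

theorem norm_taylor_le_of_uniformContinuous {f : E → F} (hf : Differentiable ℝ f)
    (hu : UniformContinuous (fderiv ℝ f)) {ε : ℝ} (hε : 0 < ε) :
    ∃ δ > 0, ∀ x h, ‖h‖ < δ → ‖f (x + h) - f x - fderiv ℝ f x h‖ ≤ ε * ‖h‖ := by
  obtain ⟨δ, hδ, H⟩ := Metric.uniformContinuous_iff.1 hu ε hε
  refine ⟨δ, hδ, fun x h hh => ?_⟩
  have := (convex_ball x δ).norm_image_sub_le_of_norm_fderiv_le' (𝕜 := ℝ) (f := f) (C := ε)
    (φ := fderiv ℝ f x) (x := x) (y := x + h) (fun y _ => hf y)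
    (fun y hy => by rw [← dist_eq_norm]; exact (H hy).le) (mem_ball_self hδ)
    (by simpa [mem_ball, dist_eq_norm] using hh)
  simpa using this

theorem hasFDerivAt_comp_continuousMap {f : E → F} (hf : ContDiff ℝ 1 f)
    (hu : UniformContinuous (fderiv ℝ f)) (u : C(K, E)) :
    HasFDerivAt (fun u : C(K, E) => (⟨f, hf.continuous⟩ : C(E, F)).comp u)
      (pointwiseApply K E F
        ((⟨fderiv ℝ f, hf.continuous_fderiv one_ne_zero⟩ : C(E, E →L[ℝ] F)).comp u)) u := by
  rw [hasFDerivAt_iff_isLittleO_nhds_zero, Asymptotics.isLittleO_iff]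
  intro ε hε
  obtain ⟨δ, hδ, H⟩ := norm_taylor_le_of_uniformContinuous (hf.differentiable one_ne_zero) hu hε
  filter_upwards [ball_mem_nhds (0 : C(K, E)) hδ] with h hh
  rw [ContinuousMap.norm_le _ (by positivity)]
  intro k
  have hk : ‖h k‖ ≤ ‖h‖ := h.norm_coe_le_norm k
  have h1 := H (u k) (h k) (hk.trans_lt (by simpa using hh))
  exact h1.trans (by gcongr)

end Superposition

/-- The derivative of superposition with `f` is superposition with `fderiv ℝ f`, followed by the
bounded linear map `pointwiseApply`. Each induction step therefore gains one order, with the target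
space changing. Compact support passes to `fderiv ℝ f` and makes it uniformly continuous, so that
the Taylor estimate is uniform over `K`. -/
theorem contDiff_nat_comp_continuousMap {K : Type*} [TopologicalSpace K] [CompactSpace K]
    {E : Type u} [NormedAddCommGroup E] [NormedSpace ℝ E]
    (n : ℕ) : ∀ {F : Type u} [NormedAddCommGroup F] [NormedSpace ℝ F] (f : E → F)
    (hf : ContDiff ℝ ∞ f), HasCompactSupport f →
    ContDiff ℝ n (fun u : C(K, E) => (⟨f, hf.continuous⟩ : C(E, F)).comp u) := by
  induction n with
  | zero =>
    intro F _ _ f hf _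
    exact contDiff_zero.2 (ContinuousMap.continuous_postcomp _)
  | succ n ih =>
    intro F _ _ f hf hc
    have hf1 : ContDiff ℝ 1 f := hf.of_le (by norm_cast)
    have hd : ContDiff ℝ ∞ (fderiv ℝ f) := hf.fderiv_right (by simp)
    have hcd : HasCompactSupport (fderiv ℝ f) := hc.fderiv ℝ
    refine contDiff_succ_iff_hasFDerivAt.2 ⟨_, ?_, fun u =>
      hasFDerivAt_comp_continuousMap hf1
        (hcd.uniformContinuous_of_continuous hd.continuous) u⟩
    exact (pointwiseApply K E F).contDiff.comp (ih (fderiv ℝ f) hd hcd)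

theorem contDiff_comp_continuousMap {K : Type*} [TopologicalSpace K] [CompactSpace K]
    {E F : Type u} [NormedAddCommGroup E] [NormedSpace ℝ E] [NormedAddCommGroup F]
    [NormedSpace ℝ F] {f : E → F} (hf : ContDiff ℝ ∞ f) (hc : HasCompactSupport f) :
    ContDiff ℝ ∞ (fun u : C(K, E) => (⟨f, hf.continuous⟩ : C(E, F)).comp u) :=
  contDiff_infty.2 fun n => contDiff_nat_comp_continuousMap n f hf hc

/-! ### Smooth local flows from the Picard integral equation -/

section Picard

variable {E : Type*} [NormedAddCommGroup E]

/-- A continuous map on the unit interval, extended to the line by constants. -/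
def extend (u : C(Icc (0 : ℝ) 1, E)) : ℝ → E := IccExtend zero_le_one u

theorem continuous_extend (u : C(Icc (0 : ℝ) 1, E)) : Continuous (extend u) :=
  u.continuous.Icc_extend'

theorem norm_extend_le (u : C(Icc (0 : ℝ) 1, E)) (s : ℝ) : ‖extend u s‖ ≤ ‖u‖ :=
  u.norm_coe_le_norm _

theorem extend_coe (u : C(Icc (0 : ℝ) 1, E)) (s : Icc (0 : ℝ) 1) : extend u s = u s :=
  IccExtend_val zero_le_one u s

variable [NormedSpace ℝ E]

variable (E) in
/-- The operator that takes a continuous map on the unit interval to its primitive. -/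
def primitive : C(Icc (0 : ℝ) 1, E) →L[ℝ] C(Icc (0 : ℝ) 1, E) :=
  LinearMap.mkContinuous
    { toFun := fun u => ⟨fun s => ∫ r in (0 : ℝ)..s, extend u r,
        (intervalIntegral.continuous_primitive
          (fun a b => (continuous_extend u).intervalIntegrable a b) 0).comp continuous_subtype_val⟩
      map_add' := fun u v => by
        ext s
        exact intervalIntegral.integral_add ((continuous_extend u).intervalIntegrable 0 s)
          ((continuous_extend v).intervalIntegrable 0 s)
      map_smul' := fun c u => by
        ext s
        exact intervalIntegral.integral_smul c (extend u) }
    1 (fun u => by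
      rw [ContinuousMap.norm_le _ (by positivity)]
      intro s
      refine (intervalIntegral.norm_integral_le_of_norm_le_const
        (fun r _ => norm_extend_le u r)).trans ?_
      rw [sub_zero, abs_of_nonneg s.2.1, one_mul]
      exact mul_le_of_le_one_right (norm_nonneg _) s.2.2)

theorem primitive_apply (u : C(Icc (0 : ℝ) 1, E)) (s : Icc (0 : ℝ) 1) :
    primitive E u s = ∫ r in (0 : ℝ)..s, extend u r := rfl

variable {f : E → E} (hf : ContDiff ℝ ∞ f)

/-- The map `(x, τ, u) ↦ (x, τ, u - x - τ ∫ f ∘ u)`; its third component vanishes exactly when `u`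
solves `u' = τ f(u)`, `u 0 = x`. -/
def picardDefect (z : (E × ℝ) × C(Icc (0 : ℝ) 1, E)) : (E × ℝ) × C(Icc (0 : ℝ) 1, E) :=
  (z.1, z.2 - (ContinuousLinearMap.const ℝ (Icc (0 : ℝ) 1) z.1.1 +
    z.1.2 • primitive E ((⟨f, hf.continuous⟩ : C(E, E)).comp z.2)))

theorem contDiff_picardDefect (hc : HasCompactSupport f) : ContDiff ℝ ∞ (picardDefect hf) := by
  have h := contDiff_comp_continuousMap (K := Icc (0 : ℝ) 1) hf hc
  unfold picardDefect
  refine contDiff_fst.prodMk (contDiff_snd.sub (ContDiff.add ?_ ?_))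
  · exact (ContinuousLinearMap.contDiff _).comp contDiff_fst.fst
  · exact contDiff_fst.snd.smul ((primitive E).contDiff.comp (h.comp contDiff_snd))

/-- The nonlinear term carries the factor `τ`. At `τ = 0` the partial derivative in `u` is therefore
the identity, and the full derivative is triangular with identity blocks, hence invertible whatever
`f` is. -/
theorem hasFDerivAt_picardDefect (hc : HasCompactSupport f) (x : E) (u : C(Icc (0 : ℝ) 1, E)) :
    ∃ A : ((E × ℝ) × C(Icc (0 : ℝ) 1, E)) ≃L[ℝ] ((E × ℝ) × C(Icc (0 : ℝ) 1, E)),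
      HasFDerivAt (picardDefect hf) (A : _ →L[ℝ] _) ((x, 0), u) := by
  have h := contDiff_comp_continuousMap (K := Icc (0 : ℝ) 1) hf hc
  set Q : C(Icc (0 : ℝ) 1, E) → C(Icc (0 : ℝ) 1, E) :=
    fun u => primitive E ((⟨f, hf.continuous⟩ : C(E, E)).comp u) with hQ
  have hQd : DifferentiableAt ℝ Q u :=
    (((primitive E).contDiff.comp h).differentiable (by simp)) u
  let L : (E × ℝ) →L[ℝ] C(Icc (0 : ℝ) 1, E) :=
    (ContinuousLinearMap.const ℝ (Icc (0 : ℝ) 1)).comp (ContinuousLinearMap.fst ℝ E ℝ) +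
      (ContinuousLinearMap.snd ℝ E ℝ).smulRight (Q u)
  refine ⟨ContinuousLinearEquiv.skewProd (.refl ℝ _) (.refl ℝ _) (-L), ?_⟩
  have h1 : HasFDerivAt (fun z : (E × ℝ) × C(Icc (0 : ℝ) 1, E) => z.1.1)
      ((ContinuousLinearMap.fst ℝ E ℝ).comp (ContinuousLinearMap.fst ℝ _ _)) ((x, 0), u) :=
    (hasFDerivAt_fst (p := (x, (0 : ℝ)))).comp _ hasFDerivAt_fst
  have h2 : HasFDerivAt (fun z : (E × ℝ) × C(Icc (0 : ℝ) 1, E) => z.1.2)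
      ((ContinuousLinearMap.snd ℝ E ℝ).comp (ContinuousLinearMap.fst ℝ _ _)) ((x, 0), u) :=
    (hasFDerivAt_snd (p := (x, (0 : ℝ)))).comp _ hasFDerivAt_fst
  have h3 : HasFDerivAt (fun z : (E × ℝ) × C(Icc (0 : ℝ) 1, E) => Q z.2)
      ((fderiv ℝ Q u).comp (ContinuousLinearMap.snd ℝ _ _)) ((x, 0), u) :=
    HasFDerivAt.comp (g := Q) ((x, (0 : ℝ)), u) hQd.hasFDerivAt hasFDerivAt_snd
  have h4 := hasFDerivAt_fst (𝕜 := ℝ) (p := ((x, (0 : ℝ)), u)) |>.prodMk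
    ((hasFDerivAt_snd (𝕜 := ℝ) (p := ((x, (0 : ℝ)), u))).sub
    (((ContinuousLinearMap.const ℝ (Icc (0 : ℝ) 1)).hasFDerivAt.comp _ h1).add (h2.smul h3)))
  refine h4.congr_fderiv ?_
  ext z <;> simp [L, sub_eq_add_neg]

variable [CompleteSpace E]

/-- Solutions are the zeros of the last component of the defect, so the slice `(z, 0)` of its local
inverse parametrizes them smoothly. -/
theorem exists_contDiffOn_picard_solution (hc : HasCompactSupport f) (x₀ : E) :
    ∃ ρ > 0, ∃ sol : E × ℝ → C(Icc (0 : ℝ) 1, E),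
      ContDiffOn ℝ ∞ sol (ball x₀ ρ ×ˢ ball 0 ρ) ∧
      ∀ z ∈ ball x₀ ρ ×ˢ ball (0 : ℝ) ρ, sol z = ContinuousLinearMap.const ℝ (Icc (0 : ℝ) 1) z.1 +
        z.2 • primitive E ((⟨f, hf.continuous⟩ : C(E, E)).comp (sol z)) := by
  have hP := contDiff_picardDefect hf hc
  set u₀ : C(Icc (0 : ℝ) 1, E) := ContinuousLinearMap.const ℝ (Icc (0 : ℝ) 1) x₀ with hu₀
  obtain ⟨A, hA⟩ := hasFDerivAt_picardDefect hf hc x₀ u₀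
  have hPa : picardDefect hf ((x₀, 0), u₀) = ((x₀, 0), 0) := by simp [picardDefect, hu₀]
  set e := hP.contDiffAt.toOpenPartialHomeomorph (picardDefect hf) hA (by simp) with he
  have hea : ((x₀, (0 : ℝ)), u₀) ∈ e.source :=
    hP.contDiffAt.mem_toOpenPartialHomeomorph_source hA (by simp)
  have hcoe : ∀ w, e w = picardDefect hf w := fun w => rfl
  have hta : ((x₀, (0 : ℝ)), (0 : C(Icc (0 : ℝ) 1, E))) ∈ e.target := by
    rw [← hPa, ← hcoe]; exact e.map_source hea
  have hsa : e.symm ((x₀, 0), 0) = ((x₀, 0), u₀) := by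
    rw [← hPa, ← hcoe]; exact e.left_inv hea
  -- Smoothness of the inverse at a point needs an invertible derivative there. Invertible operators
  -- form an open set, so one neighbourhood serves all nearby points.
  have hinv : ∀ᶠ w in 𝓝 ((x₀, (0 : ℝ)), u₀), ∃ B : ((E × ℝ) × C(Icc (0 : ℝ) 1, E)) ≃L[ℝ]
      ((E × ℝ) × C(Icc (0 : ℝ) 1, E)), (B : _ →L[ℝ] _) = fderiv ℝ (picardDefect hf) w := by
    have hcont := (hP.continuous_fderiv (by simp)).continuousAt (x := ((x₀, (0 : ℝ)), u₀))
    rw [ContinuousAt, hA.fderiv] at hcont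
    exact hcont.eventually (ContinuousLinearEquiv.nhds A)
  have hev : ∀ᶠ y in 𝓝 ((x₀, (0 : ℝ)), (0 : C(Icc (0 : ℝ) 1, E))),
      y ∈ e.target ∧ ContDiffAt ℝ ∞ e.symm y := by
    have hcs := e.continuousAt_symm hta
    rw [ContinuousAt, hsa] at hcs
    filter_upwards [e.open_target.mem_nhds hta, hcs.eventually hinv] with y hy hB
    obtain ⟨B, hB⟩ := hB
    refine ⟨hy, e.contDiffAt_symm (f₀' := B) hy ?_ hP.contDiffAt⟩
    rw [hB]
    exact (hP.differentiable (by simp) _).hasFDerivAt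
  have hι : Continuous (fun z : E × ℝ => (z, (0 : C(Icc (0 : ℝ) 1, E)))) := by fun_prop
  obtain ⟨ρ, hρ, H⟩ := Metric.eventually_nhds_iff_ball.1
    ((hι.continuousAt (x := (x₀, (0 : ℝ)))).eventually hev)
  refine ⟨ρ, hρ, fun z => (e.symm (z, 0)).2, ?_, ?_⟩
  · intro z hz
    rw [ball_prod_same] at hz
    refine ContDiffAt.contDiffWithinAt ?_
    have h1 : ContDiffAt ℝ ∞ (fun z : E × ℝ => (z, (0 : C(Icc (0 : ℝ) 1, E)))) z :=
      contDiffAt_id.prodMk contDiffAt_const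
    exact contDiffAt_snd.comp z (((H z hz).2).comp z h1)
  · intro z hz
    rw [ball_prod_same] at hz
    have h1 := e.right_inv (H z hz).1
    rw [hcoe] at h1
    simp only [picardDefect, Prod.mk.injEq] at h1
    obtain ⟨h2, h3⟩ := h1
    rw [h2] at h3
    exact sub_eq_zero.1 h3

theorem hasDerivWithinAt_of_picard {x : E} {τ : ℝ} {u : C(Icc (0 : ℝ) 1, E)}
    (hu : u = ContinuousLinearMap.const ℝ (Icc (0 : ℝ) 1) x +
        τ • primitive E ((⟨f, hf.continuous⟩ : C(E, E)).comp u)) :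
    extend u 0 = x ∧ ∀ s ∈ Icc (0 : ℝ) 1,
      HasDerivWithinAt (extend u) (τ • f (extend u s)) (Icc 0 1) s := by
  have hext : ∀ s, extend ((⟨f, hf.continuous⟩ : C(E, E)).comp u) s = f (extend u s) :=
    fun s => rfl
  have hval : ∀ s ∈ Icc (0 : ℝ) 1, extend u s = x + τ • ∫ r in (0 : ℝ)..s, f (extend u r) := by
    intro s hs
    have := congrArg (fun v : C(Icc (0 : ℝ) 1, E) => v ⟨s, hs⟩) hu
    simp only [ContinuousMap.add_apply, ContinuousMap.smul_apply, primitive_apply, hext] at this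
    rw [← extend_coe] at this
    exact this
  refine ⟨by simpa using hval 0 (by simp), fun s hs => ?_⟩
  have hcont : Continuous (fun r => f (extend u r)) := hf.continuous.comp (continuous_extend u)
  have hd : HasDerivAt (fun s => x + τ • ∫ r in (0 : ℝ)..s, f (extend u r))
      (τ • f (extend u s)) s :=
    ((intervalIntegral.integral_hasDerivAt_right (hcont.intervalIntegrable _ _)
      (hcont.stronglyMeasurableAtFilter _ _) hcont.continuousAt).const_smul τ).const_add x
  exact hd.hasDerivWithinAt.congr hval (hval s hs)

/-- A smooth compactly supported vector field has a local flow that is jointly smooth in the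
initial value and the time. -/
theorem exists_contDiffOn_flow (hf : ContDiff ℝ ∞ f) (hc : HasCompactSupport f) (x₀ : E) :
    ∃ ρ > 0, ∃ φ : E × ℝ → E, ContDiffOn ℝ ∞ φ (ball x₀ ρ ×ˢ ball 0 ρ) ∧
      ∀ x ∈ ball x₀ ρ, φ (x, 0) = x ∧
        ∀ t ∈ ball (0 : ℝ) ρ, HasDerivAt (fun t => φ (x, t)) (f (φ (x, t))) t := by
  obtain ⟨ρ₁, hρ₁, sol, hsol, heq⟩ := exists_contDiffOn_picard_solution hf hc x₀
  obtain ⟨r, hr, ε, hε, H⟩ := (hf.contDiffAt (x := x₀)).of_le (m := 1) (by norm_cast)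
    |>.exists_forall_mem_closedBall_exists_eq_forall_mem_Ioo_hasDerivAt 0
  obtain ⟨C, hC⟩ := (hf.of_le (m := 1) (by norm_cast)).lipschitzWith_of_hasCompactSupport hc
    one_ne_zero
  set ρ := min ρ₁ (min r ε) with hρ
  have hρpos : 0 < ρ := lt_min hρ₁ (lt_min hr hε)
  have hsub : ball x₀ ρ ×ˢ ball (0 : ℝ) ρ ⊆ ball x₀ ρ₁ ×ˢ ball 0 ρ₁ :=
    prod_mono (ball_subset_ball (min_le_left _ _)) (ball_subset_ball (min_le_left _ _))
  -- Both `sol (x, t)` and `s ↦ α (t * s)` solve the equation with right-hand side `t • f` on `[0,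
  -- 1]`, where `α` is the Picard–Lindelöf solution. By uniqueness they agree, and at `s = 1` the
  -- smooth parameter `t` becomes the time of the flow. The derivative in `t` is then read off from
  -- `α`.
  have key : ∀ x ∈ ball x₀ ρ, ∃ α : ℝ → E, α 0 = x ∧
      (∀ t ∈ ball (0 : ℝ) ρ, HasDerivAt α (f (α t)) t) ∧
      ∀ t ∈ ball (0 : ℝ) ρ, sol (x, t) 1 = α t := by
    intro x hx
    obtain ⟨α, hα0, hα⟩ := H x
      (ball_subset_closedBall (ball_subset_ball ((min_le_right _ _).trans (min_le_left _ _)) hx))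
    have hα' : ∀ t ∈ ball (0 : ℝ) ρ, HasDerivAt α (f (α t)) t := fun t ht => hα t (by
      rw [← Real.ball_eq_Ioo]
      exact ball_subset_ball ((min_le_right _ _).trans (min_le_right _ _)) ht)
    refine ⟨α, hα0, hα', fun t ht => ?_⟩
    obtain ⟨h0, hd⟩ := hasDerivWithinAt_of_picard hf (heq (x, t) (hsub ⟨hx, ht⟩))
    have hmem : ∀ s ∈ Icc (0 : ℝ) 1, t * s ∈ ball (0 : ℝ) ρ := by
      intro s hs
      rw [mem_ball_zero_iff] at ht ⊢
      rw [norm_mul, Real.norm_of_nonneg hs.1]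
      exact (mul_le_of_le_one_right (norm_nonneg _) hs.2).trans_lt ht
    have hβ : ∀ s ∈ Icc (0 : ℝ) 1, HasDerivAt (fun s => α (t * s)) (t • f (α (t * s))) s := by
      intro s hs
      have := (hα' _ (hmem s hs)).scomp s ((hasDerivAt_id s).const_mul t)
      simpa [Function.comp_def] using this
    have := ODE_solution_unique (v := fun _ y => t • f y) (K := ‖t‖₊ * C)
      (f := extend (sol (x, t))) (g := fun s => α (t * s)) (a := 0) (b := 1)
      (fun _ => (lipschitzWith_smul t).comp hC) (continuous_extend _).continuousOn
      (fun s hs => ((hd s ⟨hs.1, hs.2.le⟩).mono_of_mem_nhdsWithin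
        (Icc_mem_nhdsGE_of_mem hs)))
      (fun s hs => (hβ s hs).continuousAt.continuousWithinAt)
      (fun s hs => (hβ s ⟨hs.1, hs.2.le⟩).hasDerivWithinAt)
      (by simp [h0, hα0])
    have h1 := this (right_mem_Icc.2 zero_le_one)
    simp only [mul_one] at h1
    rw [← h1]
    exact (extend_coe (sol (x, t)) 1).symm
  refine ⟨ρ, hρpos, fun z => sol z 1, ?_, fun x hx => ?_⟩
  · exact ((ContinuousMap.evalCLM ℝ (1 : Icc (0 : ℝ) 1)).contDiff (n := ∞)).comp_contDiffOn
      (hsol.mono hsub)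
  · obtain ⟨α, hα0, hα, hs⟩ := key x hx
    refine ⟨(hs 0 (mem_ball_self hρpos)).trans hα0, fun t ht => ?_⟩
    change HasDerivAt (fun t => sol (x, t) 1) (f (sol (x, t) 1)) t
    rw [hs t ht]
    refine (hα t ht).congr_of_eventuallyEq ?_
    filter_upwards [isOpen_ball.mem_nhds ht] with s hs' using hs s hs'

end Picard

theorem comp_smulRight_one {F F' : Type*} [NormedAddCommGroup F] [NormedSpace ℝ F]
    [NormedAddCommGroup F'] [NormedSpace ℝ F'] (A : F →L[ℝ] F') (v : F) :
    A.comp ((1 : ℝ →L[ℝ] ℝ).smulRight v) = (1 : ℝ →L[ℝ] ℝ).smulRight (A v) := by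
  ext
  simp

theorem comp_prod_smulRight_one {F₁ F₂ F' : Type*} [NormedAddCommGroup F₁] [NormedSpace ℝ F₁]
    [NormedAddCommGroup F₂] [NormedSpace ℝ F₂] [NormedAddCommGroup F'] [NormedSpace ℝ F']
    (A : F₁ × F₂ →L[ℝ] F') (v : F₁) (w : F₂) :
    A.comp (((1 : ℝ →L[ℝ] ℝ).smulRight v).prod ((1 : ℝ →L[ℝ] ℝ).smulRight w)) =
      (1 : ℝ →L[ℝ] ℝ).smulRight (A (v, w)) := by
  ext
  simp

/-! ### Local flows on manifolds -/

section LocalFlow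

variable {E : Type*} [NormedAddCommGroup E] [NormedSpace ℝ E]
  {G : Type*} [TopologicalSpace G] [ChartedSpace E G] [IsManifold 𝓘(ℝ, E) ∞ G]

/-- The coordinate expression of a vector field in the preferred chart at `x₀`. -/
def chartField (Y : ∀ g : G, TangentSpace 𝓘(ℝ, E) g) (x₀ : G) (x : E) : E :=
  mfderiv 𝓘(ℝ, E) 𝓘(ℝ, E) (extChartAt 𝓘(ℝ, E) x₀) ((extChartAt 𝓘(ℝ, E) x₀).symm x)
    (Y ((extChartAt 𝓘(ℝ, E) x₀).symm x))

/-- The fibre coordinate of the tangent bundle trivialization at `x₀` is the derivative of the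
chart, so `chartField` is the smooth section read in that trivialization. -/
theorem contDiffOn_chartField {Y : ∀ g : G, TangentSpace 𝓘(ℝ, E) g} {W : Set G}
    (hY : ContMDiffOn 𝓘(ℝ, E) 𝓘(ℝ, E).tangent ∞
      (fun g => (⟨g, Y g⟩ : TangentBundle 𝓘(ℝ, E) G)) W) (x₀ : G) :
    ContDiffOn ℝ ∞ (chartField Y x₀)
      ((extChartAt 𝓘(ℝ, E) x₀).target ∩ (extChartAt 𝓘(ℝ, E) x₀).symm ⁻¹' W) := by
  have : IsManifold 𝓘(ℝ, E) 1 G := .of_le (n := ∞) (by norm_cast)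
  rw [← contMDiffOn_iff_contDiffOn]
  have h1 := (contMDiffOn_extChartAt_symm (I := 𝓘(ℝ, E)) (n := ∞) x₀).mono
    (inter_subset_left (t := (extChartAt 𝓘(ℝ, E) x₀).symm ⁻¹' W))
  have h2 := hY.comp h1 (fun x hx => hx.2)
  have h3 := (Bundle.Trivialization.contMDiffOn (n := ∞) (IB := 𝓘(ℝ, E))
    (trivializationAt E (TangentSpace 𝓘(ℝ, E) : G → Type _) x₀)).comp h2 (fun x hx => by
      rw [mem_preimage, TangentBundle.trivializationAt_source]
      have := (extChartAt 𝓘(ℝ, E) x₀).map_target hx.1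
      rwa [extChartAt_source] at this)
  refine (contMDiff_snd.comp_contMDiffOn h3).congr fun x hx => ?_
  have hs : (extChartAt 𝓘(ℝ, E) x₀).symm x ∈ (chartAt E x₀).source := by
    have := (extChartAt 𝓘(ℝ, E) x₀).map_target hx.1
    rwa [extChartAt_source] at this
  have hl := congrArg (fun A : E →L[ℝ] E => A (Y ((extChartAt 𝓘(ℝ, E) x₀).symm x)))
    (TangentBundle.continuousLinearMapAt_trivializationAt (I := 𝓘(ℝ, E)) hs)
  refine hl.symm.trans ?_
  have hb : (extChartAt 𝓘(ℝ, E) x₀).symm x ∈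
      (trivializationAt E (TangentSpace 𝓘(ℝ, E) : G → Type _) x₀).baseSet := hs
  exact congrFun (Bundle.Trivialization.coe_linearMapAt_of_mem (R := ℝ) _ hb) _

variable [FiniteDimensional ℝ E]

/-- A smooth vector field has, near every point, a local flow that is jointly smooth in the
initial value and the time. -/
theorem exists_contMDiffOn_flow {Y : ∀ g : G, TangentSpace 𝓘(ℝ, E) g} {W : Set G}
    (hW : IsOpen W) (hY : ContMDiffOn 𝓘(ℝ, E) 𝓘(ℝ, E).tangent ∞
      (fun g => (⟨g, Y g⟩ : TangentBundle 𝓘(ℝ, E) G)) W) {x₀ : G} (hx₀ : x₀ ∈ W) :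
    ∃ ε > 0, ∃ V : Set G, IsOpen V ∧ x₀ ∈ V ∧ V ⊆ W ∧ ∃ φ : G × ℝ → G,
      ContMDiffOn (𝓘(ℝ, E).prod 𝓘(ℝ, ℝ)) 𝓘(ℝ, E) ∞ φ (V ×ˢ Ioo (-ε) ε) ∧
      ∀ g ∈ V, φ (g, 0) = g ∧ MapsTo (fun t => φ (g, t)) (Ioo (-ε) ε) W ∧
        IsMIntegralCurveOn (fun t => φ (g, t)) Y (Ioo (-ε) ε) := by
  have : IsManifold 𝓘(ℝ, E) 1 G := .of_le (n := ∞) (by norm_cast)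
  set e := extChartAt 𝓘(ℝ, E) x₀ with he
  set O := e.target ∩ e.symm ⁻¹' W with hO
  have hOo : IsOpen O :=
    (continuousOn_extChartAt_symm (I := 𝓘(ℝ, E)) x₀).isOpen_inter_preimage
      (isOpen_extChartAt_target x₀) hW
  have hxO : e x₀ ∈ O :=
    ⟨mem_extChartAt_target x₀, by rw [mem_preimage, extChartAt_to_inv]; exact hx₀⟩
  obtain ⟨R, hR, hRO⟩ := Metric.isOpen_iff.1 hOo _ hxO
  -- The cut-off field has compact support in `O` and equals the coordinate field on the ball of
  -- radius `R / 4`. Below, initial points and times are restricted so that flow lines do not leave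
  -- this ball.
  let χ : ContDiffBump (e x₀) := ⟨R / 4, R / 2, by positivity, by linarith⟩
  have hχO : tsupport χ ⊆ O := by
    rw [χ.tsupport_eq]
    exact (closedBall_subset_ball (by change R / 2 < R; linarith)).trans hRO
  set f : E → E := fun x => χ x • chartField Y x₀ x with hf
  have hfc : HasCompactSupport f := χ.hasCompactSupport.smul_right
  have hfs : ContDiff ℝ ∞ f := by
    rw [contDiff_iff_contDiffAt]
    intro x
    by_cases hx : x ∈ tsupport χ
    · exact (χ.contDiff.contDiffAt).smul
        ((contDiffOn_chartField hY x₀).contDiffAt (hOo.mem_nhds (hχO hx)))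
    · refine (contDiffAt_const (c := (0 : E))).congr_of_eventuallyEq ?_
      filter_upwards [(isClosed_tsupport χ).isOpen_compl.mem_nhds hx] with y hy
      rw [hf]
      simp only [image_eq_zero_of_notMem_tsupport hy, zero_smul]
  have hfeq : ∀ x ∈ ball (e x₀) (R / 4), f x = chartField Y x₀ x := fun x hx => by
    rw [hf]
    simp only [χ.one_of_mem_closedBall (ball_subset_closedBall hx), one_smul]
  obtain ⟨ρ, hρ, φ, hφ, hflow⟩ := exists_contDiffOn_flow hfs hfc (e x₀)
  have hφ0 : φ (e x₀, 0) = e x₀ := (hflow _ (mem_ball_self hρ)).1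
  have hcont : ContinuousAt φ (e x₀, 0) := hφ.continuousOn.continuousAt
    (prod_mem_nhds (ball_mem_nhds _ hρ) (ball_mem_nhds _ hρ))
  have hnear : ∀ᶠ z in 𝓝 (e x₀, (0 : ℝ)), φ z ∈ ball (e x₀) (R / 4) :=
    hcont.eventually (by rw [hφ0]; exact ball_mem_nhds _ (by positivity))
  obtain ⟨σ, hσ, hσ'⟩ := Metric.eventually_nhds_iff_ball.1 hnear
  set ε := min ρ σ with hε
  have hεpos : 0 < ε := lt_min hρ hσ
  have hsub : ball (e x₀) ε ×ˢ ball (0 : ℝ) ε ⊆ ball (e x₀) ρ ×ˢ ball 0 ρ :=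
    prod_mono (ball_subset_ball (min_le_left _ _)) (ball_subset_ball (min_le_left _ _))
  have hball : ∀ x ∈ ball (e x₀) ε, ∀ t ∈ ball (0 : ℝ) ε, φ (x, t) ∈ ball (e x₀) (R / 4) := by
    intro x hx t ht
    refine hσ' _ ?_
    rw [← ball_prod_same]
    exact ⟨ball_subset_ball (min_le_right _ _) hx, ball_subset_ball (min_le_right _ _) ht⟩
  have hR4 : ball (e x₀) (R / 4) ⊆ O :=
    (ball_subset_ball (by linarith)).trans hRO
  have hIoo : Ioo (-ε) ε = ball (0 : ℝ) ε := by rw [Real.ball_eq_Ioo]; simp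
  refine ⟨ε, hεpos, ?_⟩
  rw [hIoo]
  refine ⟨(e.source ∩ e ⁻¹' ball (e x₀) ε) ∩ W, ?_, ?_, inter_subset_right,
    fun z => e.symm (φ (e z.1, z.2)), ?_, ?_⟩
  · exact ((continuousOn_extChartAt (I := 𝓘(ℝ, E)) x₀).isOpen_inter_preimage
      (isOpen_extChartAt_source x₀) isOpen_ball).inter hW
  · exact ⟨⟨mem_extChartAt_source x₀, mem_ball_self hεpos⟩, hx₀⟩
  · have h1 : ContMDiffOn (𝓘(ℝ, E).prod 𝓘(ℝ, ℝ)) 𝓘(ℝ, E × ℝ) ∞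
        (fun z : G × ℝ => (e z.1, z.2))
        (((e.source ∩ e ⁻¹' ball (e x₀) ε) ∩ W) ×ˢ ball (0 : ℝ) ε) := by
      refine ContMDiffOn.prodMk_space ?_ contMDiff_snd.contMDiffOn
      refine (contMDiffOn_extChartAt (I := 𝓘(ℝ, E)) (x := x₀)).comp contMDiff_fst.contMDiffOn ?_
      intro z hz
      have := hz.1.1.1
      rwa [he, extChartAt_source] at this
    have h2 := (contMDiffOn_iff_contDiffOn.2 (hφ.mono hsub)).comp h1
      (fun z hz => ⟨hz.1.1.2, hz.2⟩)
    exact (contMDiffOn_extChartAt_symm (I := 𝓘(ℝ, E)) (n := ∞) x₀).comp h2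
      (fun z hz => (hR4 (hball _ hz.1.1.2 _ hz.2)).1)
  · intro g hg
    refine ⟨?_, fun t ht => (hR4 (hball _ hg.1.2 t ht)).2, fun t ht => ?_⟩
    · have := (hflow (e g) (ball_subset_ball (min_le_left _ _) hg.1.2)).1
      simp only [this]
      exact e.left_inv hg.1.1
    · refine HasMFDerivAt.hasMFDerivWithinAt ?_
      have hd := (hflow (e g) (ball_subset_ball (min_le_left _ _) hg.1.2)).2 t
        (ball_subset_ball (min_le_left _ _) ht)
      have hb := hball _ hg.1.2 t ht
      rw [hfeq _ hb] at hd
      change HasMFDerivAt 𝓘(ℝ, ℝ) 𝓘(ℝ, E) (fun t => e.symm (φ (e g, t))) t _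
      have htar := (hR4 hb).1
      have hs := mdifferentiableWithinAt_extChartAt_symm (I := 𝓘(ℝ, E)) htar
      have hs' : MDifferentiableAt 𝓘(ℝ, E) 𝓘(ℝ, E) e.symm (φ (e g, t)) := by
        rwa [modelWithCornersSelf_coe, range_id, mdifferentiableWithinAt_univ] at hs
      have hcomp := hs'.hasMFDerivAt.comp t (hasMFDerivAt_iff_hasFDerivAt.2 hd.hasFDerivAt)
      refine hcomp.congr_mfderiv ?_
      have hinv := mfderivWithin_extChartAt_symm_comp_mfderiv_extChartAt (I := 𝓘(ℝ, E)) htar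
      simp only [modelWithCornersSelf_coe, range_id, mfderivWithin_univ] at hinv
      have hv := DFunLike.congr_fun hinv (Y (e.symm (φ (e g, t))))
      exact (comp_smulRight_one (F := E) (F' := E) _ _).trans
        (congrArg (ContinuousLinearMap.smulRight (1 : ℝ →L[ℝ] ℝ)) hv)

end LocalFlow

end SmoothFlow

namespace GroupBundles

/-! ### Uniqueness, composition and global smoothness of flows -/

section Flow

variable {N : ℕ} {G : Type*} [TopologicalSpace G] [ChartedSpace (EuclideanSpace ℝ (Fin N)) G]
  {Y : ∀ g : G, TangentSpace (𝓡 N) g} {W : Set G}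

theorem FlowsTo.of_curve {γ : ℝ → G} {a b s t : ℝ} (hγ : IsMIntegralCurveOn γ Y (Ioo a b))
    (hm : MapsTo γ (Ioo a b) W) (hs : s ∈ Ioo a b) (ht : t ∈ Ioo a b) :
    FlowsTo Y W (t - s) (γ s) (γ t) := by
  have hset : {r | r + s ∈ Ioo a b} = Ioo (a - s) (b - s) := by
    ext r; simp [sub_lt_iff_lt_add, lt_sub_iff_add_lt]
  refine ⟨γ ∘ (· + s), a - s, b - s, ⟨by linarith [hs.1], by linarith [hs.2]⟩,
    ⟨by linarith [ht.1], by linarith [ht.2]⟩, ?_, ?_, by simp, by simp⟩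
  · intro r hr
    exact hm (by rw [← hset] at hr; exact hr)
  · have := hγ.comp_add s
    rwa [hset] at this

theorem FlowsTo.mem_left {t : ℝ} {g g' : G} (h : FlowsTo Y W t g g') : g ∈ W := by
  obtain ⟨γ, a, b, h0, ht, hm, hγ, rfl, rfl⟩ := h
  exact hm h0

theorem FlowsTo.mem_right {t : ℝ} {g g' : G} (h : FlowsTo Y W t g g') : g' ∈ W := by
  obtain ⟨γ, a, b, h0, ht, hm, hγ, rfl, rfl⟩ := h
  exact hm ht

theorem FlowsTo.symm {t : ℝ} {g g' : G} (h : FlowsTo Y W t g g') : FlowsTo Y W (-t) g' g := by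
  obtain ⟨γ, a, b, h0, ht, hm, hγ, rfl, rfl⟩ := h
  simpa using FlowsTo.of_curve hγ hm ht h0

variable [T2Space G] [IsManifold (𝓡 N) ∞ G]

/-- Agreement at one time spreads to nearby times by local uniqueness, and disagreement by the
Hausdorff property. Agreement is thus constant on the connected interval. -/
theorem eqOn_of_integralCurves (hW : IsOpen W)
    (hY : ContMDiffOn (𝓡 N) (𝓡 N).tangent ∞ (fun g => (⟨g, Y g⟩ : TangentBundle (𝓡 N) G)) W)
    {γ γ' : ℝ → G} {a b t₀ : ℝ} (ht₀ : t₀ ∈ Ioo a b) (hm : MapsTo γ (Ioo a b) W)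
    (hγ : IsMIntegralCurveOn γ Y (Ioo a b)) (hγ' : IsMIntegralCurveOn γ' Y (Ioo a b))
    (h : γ t₀ = γ' t₀) : EqOn γ γ' (Ioo a b) := by
  have : IsManifold (𝓡 N) 1 G := .of_le (n := ∞) (by norm_cast)
  have hloc : ∀ t ∈ Ioo a b, γ t = γ' t → γ =ᶠ[𝓝 t] γ' := by
    intro t ht hteq
    have hmem := Ioo_mem_nhds ht.1 ht.2
    exact isMIntegralCurveAt_eventuallyEq_of_contMDiffAt_boundaryless
      ((hY.contMDiffAt (hW.mem_nhds (hm ht))).of_le (by norm_cast))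
      (hγ.isMIntegralCurveAt hmem) (hγ'.isMIntegralCurveAt hmem) hteq
  have hcl : ∀ t ∈ Ioo a b, ∀ᶠ s in 𝓝[Ioo a b] t, (γ t = γ' t ↔ γ s = γ' s) := by
    intro t ht
    by_cases hteq : γ t = γ' t
    · filter_upwards [nhdsWithin_le_nhds (hloc t ht hteq)] with s hs
      simp [hteq, hs]
    · have hne : Tendsto (fun s => (γ s, γ' s)) (𝓝[Ioo a b] t) (𝓝 (γ t, γ' t)) :=
        (hγ.continuousWithinAt ht).prodMk_nhds (hγ'.continuousWithinAt ht)
      filter_upwards [hne (isClosed_diagonal.isOpen_compl.mem_nhds hteq)] with s hs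
      have : γ s ≠ γ' s := hs
      simp [hteq, this]
  intro t ht
  exact (isPreconnected_Ioo.induction₂ (fun x y => γ x = γ' x ↔ γ y = γ' y) hcl
    (fun _ _ _ _ _ _ => Iff.trans) (fun _ _ _ _ => Iff.symm) ht₀ ht).1 h

theorem FlowsTo.unique (hW : IsOpen W)
    (hY : ContMDiffOn (𝓡 N) (𝓡 N).tangent ∞ (fun g => (⟨g, Y g⟩ : TangentBundle (𝓡 N) G)) W)
    {t : ℝ} {g g₁ g₂ : G} (h₁ : FlowsTo Y W t g g₁) (h₂ : FlowsTo Y W t g g₂) : g₁ = g₂ := by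
  obtain ⟨γ, a, b, h0, ht, hm, hγ, rfl, rfl⟩ := h₁
  obtain ⟨γ', a', b', h0', ht', hm', hγ', h, rfl⟩ := h₂
  have hi : Ioo (max a a') (min b b') = Ioo a b ∩ Ioo a' b' := Ioo_inter_Ioo.symm
  refine eqOn_of_integralCurves hW hY (a := max a a') (b := min b b') (t₀ := 0) ?_ ?_ ?_ ?_ h.symm ?_
  · rw [hi]; exact ⟨h0, h0'⟩
  · rw [hi]; exact hm.mono_left inter_subset_left
  · rw [hi]; exact hγ.mono inter_subset_left
  · rw [hi]; exact hγ'.mono inter_subset_right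
  · rw [hi]; exact ⟨ht, ht'⟩

theorem FlowsTo.trans (hW : IsOpen W)
    (hY : ContMDiffOn (𝓡 N) (𝓡 N).tangent ∞ (fun g => (⟨g, Y g⟩ : TangentBundle (𝓡 N) G)) W)
    {s t : ℝ} {g g₁ g₂ : G} (h₁ : FlowsTo Y W s g g₁) (h₂ : FlowsTo Y W t g₁ g₂) :
    FlowsTo Y W (s + t) g g₂ := by
  classical
  obtain ⟨γ, a, b, h0, hs, hm, hγ, rfl, rfl⟩ := h₁
  obtain ⟨η, a', b', h0', ht, hm', hη, h, rfl⟩ := h₂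
  set η' : ℝ → G := η ∘ (· + -s) with hη'
  have hset : {r | r + -s ∈ Ioo a' b'} = Ioo (a' + s) (b' + s) := by
    ext r; simp [← sub_eq_add_neg, sub_lt_iff_lt_add, lt_sub_iff_add_lt]
  have hηc : IsMIntegralCurveOn η' Y (Ioo (a' + s) (b' + s)) := by
    have := hη.comp_add (-s)
    rwa [hset] at this
  have hηm : MapsTo η' (Ioo (a' + s) (b' + s)) W := fun r hr => hm' (by rw [← hset] at hr; exact hr)
  have hs' : s ∈ Ioo (a' + s) (b' + s) := ⟨by linarith [h0'.1], by linarith [h0'.2]⟩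
  have heq : EqOn γ η' (Ioo a b ∩ Ioo (a' + s) (b' + s)) := by
    have hi : Ioo a b ∩ Ioo (a' + s) (b' + s) = Ioo (max a (a' + s)) (min b (b' + s)) :=
      Ioo_inter_Ioo
    rw [hi]
    refine eqOn_of_integralCurves hW hY (t₀ := s) ?_ ?_ ?_ ?_ (by simp [hη', h])
    · rw [← hi]; exact ⟨hs, hs'⟩
    · rw [← hi]; exact hm.mono_left inter_subset_left
    · rw [← hi]; exact hγ.mono inter_subset_left
    · rw [← hi]; exact hηc.mono inter_subset_right
  set ζ : ℝ → G := (Ioo a b).piecewise γ η' with hζ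
  have hζ1 : EqOn ζ γ (Ioo a b) := piecewise_eqOn _ _ _
  have hζ2 : EqOn ζ η' (Ioo (a' + s) (b' + s)) := by
    intro r hr
    by_cases hra : r ∈ Ioo a b
    · rw [hζ1 hra, heq ⟨hra, hr⟩]
    · exact piecewise_eq_of_notMem _ _ _ hra
  have hun : Ioo (min a (a' + s)) (max b (b' + s)) = Ioo a b ∪ Ioo (a' + s) (b' + s) :=
    (Ioo_union_Ioo' (by linarith [hs'.1, hs.2]) (by linarith [hs'.2, hs.1])).symm
  have hζm : MapsTo ζ (Ioo (min a (a' + s)) (max b (b' + s))) W := by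
    rw [hun]
    rintro r (hr | hr)
    · rw [hζ1 hr]; exact hm hr
    · rw [hζ2 hr]; exact hηm hr
  have hζc : IsMIntegralCurveOn ζ Y (Ioo (min a (a' + s)) (max b (b' + s))) := by
    rw [hun]
    intro r hr
    refine HasMFDerivAt.hasMFDerivWithinAt ?_
    rcases hr with hr | hr
    · have hn := Ioo_mem_nhds hr.1 hr.2
      rw [hζ1 hr]
      exact ((hγ r hr).hasMFDerivAt hn).congr_of_eventuallyEq (hζ1.eventuallyEq_of_mem hn)
    · have hn := Ioo_mem_nhds hr.1 hr.2
      rw [hζ2 hr]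
      exact ((hηc r hr).hasMFDerivAt hn).congr_of_eventuallyEq (hζ2.eventuallyEq_of_mem hn)
  have hst : s + t ∈ Ioo (a' + s) (b' + s) := ⟨by linarith [ht.1], by linarith [ht.2]⟩
  refine ⟨ζ, _, _, ?_, ?_, hζm, hζc, hζ1 h0, ?_⟩
  · rw [hun]; exact Or.inl h0
  · rw [hun]; exact Or.inr hst
  · rw [hζ2 hst]; simp [hη']

/-- A local flow `ψ` gives smoothness near time zero. The flow law `φ (h, u) = ψ (φ (h, r), u - r)`
carries smoothness from one time to a nearby one, in both directions. Along the connected time slice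
of `D` at `g`, smoothness is therefore locally constant, and it holds at time zero. -/
theorem contMDiffOn_of_flowsTo (hW : IsOpen W)
    (hY : ContMDiffOn (𝓡 N) (𝓡 N).tangent ∞ (fun g => (⟨g, Y g⟩ : TangentBundle (𝓡 N) G)) W)
    {D : Set (G × ℝ)} (hD : IsOpen D) (hpre : ∀ g, IsPreconnected {t | (g, t) ∈ D})
    (hzero : ∀ g t, (g, t) ∈ D → (g, (0 : ℝ)) ∈ D) {φ : G × ℝ → G}
    (hφ : ∀ z ∈ D, FlowsTo Y W z.2 z.1 (φ z)) :
    ContMDiffOn ((𝓡 N).prod 𝓘(ℝ, ℝ)) (𝓡 N) ∞ φ D := by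
  -- Smoothness is required on a neighbourhood because the flow law, near `(g, s)`, uses `φ` at `(h,
  -- r)` for all `h` near `g`.
  let S : G → ℝ → Prop := fun g t =>
    ∀ᶠ z in 𝓝 (g, t), ContMDiffAt ((𝓡 N).prod 𝓘(ℝ, ℝ)) (𝓡 N) ∞ φ z
  suffices H : ∀ g t, (g, t) ∈ D → S g t from fun z hz =>
    ((H z.1 z.2 hz).self_of_nhds).contMDiffWithinAt
  have hS0 : ∀ g t, (g, t) ∈ D → S g 0 := by
    intro g t hgt
    have hg0 := hzero g t hgt
    obtain ⟨ε, hε, V, hV, hgV, -, ψ, hψ, hψ'⟩ :=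
      SmoothFlow.exists_contMDiffOn_flow hW hY (hφ _ hg0).mem_left
    have hO : IsOpen (V ×ˢ Ioo (-ε) ε) := hV.prod isOpen_Ioo
    have hmem : (g, (0 : ℝ)) ∈ D ∩ V ×ˢ Ioo (-ε) ε := ⟨hg0, hgV, by simp [hε]⟩
    have hev : ∀ z ∈ D ∩ V ×ˢ Ioo (-ε) ε, φ z = ψ z := by
      rintro ⟨h, s⟩ ⟨hz, hh, hs⟩
      obtain ⟨h1, h2, h3⟩ := hψ' h hh
      refine (hφ _ hz).unique hW hY ?_
      have := FlowsTo.of_curve h3 h2 (s := 0) (t := s) (by simp [hε]) hs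
      simpa [h1] using this
    filter_upwards [(hD.inter hO).mem_nhds hmem] with z hz
    refine (hψ.contMDiffAt (hO.mem_nhds hz.2)).congr_of_eventuallyEq ?_
    filter_upwards [(hD.inter hO).mem_nhds hz] with w hw using hev w hw
  have hstep : ∀ g t, (g, t) ∈ D → ∀ᶠ s in 𝓝[{t | (g, t) ∈ D}] t,
      ((S g t → S g s) ∧ (S g s → S g t)) := by
    intro g t hgt
    obtain ⟨ε, hε, V, hV, hgV, -, ψ, hψ, hψ'⟩ :=
      SmoothFlow.exists_contMDiffOn_flow hW hY (hφ _ hgt).mem_right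
    have hO : IsOpen (V ×ˢ Ioo (-ε) ε) := hV.prod isOpen_Ioo
    -- The single box `V` around `φ (g, t)` serves for passing from `t` to `s` and from `s` back to
    -- `t`.
    have key : ∀ r s, (g, r) ∈ D → (g, s) ∈ D → φ (g, r) ∈ V → s - r ∈ Ioo (-ε) ε →
        S g r → S g s := by
      intro r s hr hs hrV hsr hSr
      have hι : Continuous (fun z : G × ℝ => (z.1, r)) := by fun_prop
      have hτ : Continuous (fun z : G × ℝ => z.2 - r) := by fun_prop
      have e1 : ∀ᶠ z in 𝓝 (g, s),
          ContMDiffAt ((𝓡 N).prod 𝓘(ℝ, ℝ)) (𝓡 N) ∞ φ (z.1, r) :=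
        (hι.tendsto (g, s)).eventually hSr
      have e2 : ∀ᶠ z in 𝓝 (g, s), (z.1, r) ∈ D :=
        (hι.tendsto (g, s)).eventually (hD.mem_nhds hr)
      have e3 : ∀ᶠ z in 𝓝 (g, s), φ (z.1, r) ∈ V :=
        (hι.tendsto (g, s)).eventually
          (hSr.self_of_nhds.continuousAt.eventually (hV.mem_nhds hrV))
      have e4 : ∀ᶠ z in 𝓝 (g, s), z.2 - r ∈ Ioo (-ε) ε :=
        (hτ.tendsto (g, s)).eventually (isOpen_Ioo.mem_nhds hsr)
      have e5 : ∀ᶠ z in 𝓝 (g, s), φ z = ψ (φ (z.1, r), z.2 - r) := by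
        filter_upwards [e2, e3, e4, hD.mem_nhds hs] with z h2 h3 h4 h5
        obtain ⟨p1, p2, p3⟩ := hψ' _ h3
        have hf := FlowsTo.of_curve p3 p2 (s := 0) (by simp [hε]) h4
        rw [p1, sub_zero] at hf
        have hf2 := (hφ _ h2).trans hW hY hf
        simp only [add_sub_cancel] at hf2
        exact (hφ z h5).unique hW hY hf2
      filter_upwards [e1, e3, e4, eventually_eventually_nhds.2 e5] with z h1 h3 h4 h5
      refine ContMDiffAt.congr_of_eventuallyEq ?_ h5
      have hψz : ContMDiffAt ((𝓡 N).prod 𝓘(ℝ, ℝ)) (𝓡 N) ∞ ψ (φ (z.1, r), z.2 - r) :=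
        hψ.contMDiffAt (hO.mem_nhds ⟨h3, h4⟩)
      have hc1 : ContMDiffAt ((𝓡 N).prod 𝓘(ℝ, ℝ)) (𝓡 N) ∞ (fun z : G × ℝ => φ (z.1, r)) z :=
        ContMDiffAt.comp (g := φ) (f := fun z : G × ℝ => (z.1, r)) z h1
          (contMDiffAt_fst.prodMk contMDiffAt_const)
      have hc2 : ContMDiffAt ((𝓡 N).prod 𝓘(ℝ, ℝ)) 𝓘(ℝ, ℝ) ∞ (fun z : G × ℝ => z.2 - r) z :=
        contMDiffAt_snd.sub contMDiffAt_const
      exact ContMDiffAt.comp (g := ψ) (f := fun z : G × ℝ => (φ (z.1, r), z.2 - r)) z hψz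
        (hc1.prodMk hc2)
    obtain ⟨γ, a, b, h0, ht, hm, hγ, hγ0, hγt⟩ := hφ _ hgt
    simp only at hγ0 hγt ht
    have hct : ContinuousAt γ t := (hγ.continuousWithinAt ht).continuousAt (Ioo_mem_nhds ht.1 ht.2)
    have e1 : ∀ᶠ s in 𝓝 t, γ s ∈ V := hct.eventually (by rw [hγt]; exact hV.mem_nhds hgV)
    have e2 : ∀ᶠ s in 𝓝 t, s ∈ Ioo a b := Ioo_mem_nhds ht.1 ht.2
    have e3 : ∀ᶠ s in 𝓝 t, s ∈ Ioo (t - ε) (t + ε) := Ioo_mem_nhds (by linarith) (by linarith)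
    filter_upwards [nhdsWithin_le_nhds e1, nhdsWithin_le_nhds e2, nhdsWithin_le_nhds e3,
      self_mem_nhdsWithin] with s h1 h2 h3 h4
    have hs : φ (g, s) = γ s := by
      refine (hφ _ h4).unique hW hY ?_
      have := FlowsTo.of_curve hγ hm h0 h2
      simpa [hγ0] using this
    exact ⟨key t s hgt h4 hgV ⟨by linarith [h3.1], by linarith [h3.2]⟩,
      key s t h4 hgt (by rw [hs]; exact h1) ⟨by linarith [h3.2], by linarith [h3.1]⟩⟩
  intro g t hgt
  exact (hpre g).induction₂' (fun s t => S g s → S g t) (hstep g)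
    (fun _ _ _ _ _ _ h1 h2 h => h2 (h1 h)) (hzero g t hgt) hgt (hS0 g t hgt)

end Flow

/-! ### Smoothness of horizontal lifts -/

section Lift

variable {m N : ℕ} {M G : Type*}
  [TopologicalSpace M] [ChartedSpace (EuclideanSpace ℝ (Fin m)) M]
  [TopologicalSpace G] [ChartedSpace (EuclideanSpace ℝ (Fin N)) G]
  {π : G → M} {c : OpenPartialHomeomorph M (EuclideanSpace ℝ (Fin m))}

/-- The differential of the coordinate expression `c ∘ π` of the projection. -/
def coordDeriv (N : ℕ) [ChartedSpace (EuclideanSpace ℝ (Fin N)) G] (π : G → M)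
    (c : OpenPartialHomeomorph M (EuclideanSpace ℝ (Fin m))) (g : G) :
    TangentSpace (𝓡 N) g →L[ℝ] EuclideanSpace ℝ (Fin m) :=
  mfderiv (𝓡 N) (𝓡 m) (c ∘ π) g

theorem mdifferentiable_of_mem_maximalAtlas (hc : c ∈ IsManifold.maximalAtlas (𝓡 m) ∞ M) :
    c.MDifferentiable (𝓡 m) (𝓡 m) :=
  ⟨(contMDiffOn_of_mem_maximalAtlas hc).mdifferentiableOn (by simp),
    (contMDiffOn_symm_of_mem_maximalAtlas hc).mdifferentiableOn (by simp)⟩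

theorem isOpen_preimage_source (B : GroupBundle m N π) : IsOpen (π ⁻¹' c.source) :=
  c.open_source.preimage B.smooth_proj.continuous

theorem contMDiffOn_coord (B : GroupBundle m N π) (hc : c ∈ IsManifold.maximalAtlas (𝓡 m) ∞ M) :
    ContMDiffOn (𝓡 N) (𝓡 m) ∞ (c ∘ π) (π ⁻¹' c.source) :=
  (contMDiffOn_of_mem_maximalAtlas hc).comp B.smooth_proj.contMDiffOn fun _ h => h

theorem hasMFDerivAt_coord (B : GroupBundle m N π) (hc : c ∈ IsManifold.maximalAtlas (𝓡 m) ∞ M) {g : G}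
    (hg : π g ∈ c.source) : HasMFDerivAt (𝓡 N) (𝓡 m) (c ∘ π) g (coordDeriv N π c g) :=
  (((contMDiffOn_coord B hc).contMDiffAt ((isOpen_preimage_source B).mem_nhds hg)).mdifferentiableAt
    (by simp)).hasMFDerivAt

theorem coordDeriv_apply (B : GroupBundle m N π) (hc : c ∈ IsManifold.maximalAtlas (𝓡 m) ∞ M) {g : G}
    (hg : π g ∈ c.source) (v : TangentSpace (𝓡 N) g) :
    coordDeriv N π c g v =
      mfderiv (𝓡 m) (𝓡 m) c (π g) (mfderiv (𝓡 N) (𝓡 m) π g v) := by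
  have h := mfderiv_comp g ((mdifferentiable_of_mem_maximalAtlas hc).mdifferentiableAt hg)
    (B.smooth_proj.mdifferentiable (by simp) g)
  exact DFunLike.congr_fun h v

theorem mfderiv_coord_symm_apply (hc : c ∈ IsManifold.maximalAtlas (𝓡 m) ∞ M) {q : M}
    (hq : q ∈ c.source) (w : EuclideanSpace ℝ (Fin m)) :
    (mfderiv (𝓡 m) (𝓡 m) c q (mfderiv (𝓡 m) (𝓡 m) c.symm (c q) w) :
      EuclideanSpace ℝ (Fin m)) = w := by
  have h := (mdifferentiable_of_mem_maximalAtlas hc).comp_symm_deriv (c.map_source hq)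
  rw [c.left_inv hq] at h
  exact DFunLike.congr_fun h w

variable [IsManifold (𝓡 N) ∞ G] {H : ∀ g : G, Submodule ℝ (TangentSpace (𝓡 N) g)}

theorem coordDeriv_lift (B : GroupBundle m N π) (hH : IsConnection m N π H)
    (hc : c ∈ IsManifold.maximalAtlas (𝓡 m) ∞ M) {g : G} (hg : π g ∈ c.source)
    (w : EuclideanSpace ℝ (Fin m)) :
    coordDeriv N π c g (horizontalLift π H
      (fun q => mfderiv (𝓡 m) (𝓡 m) c.symm (c q) w) g) = w := by
  rw [coordDeriv_apply B hc hg]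
  refine (congrArg (mfderiv (𝓡 m) (𝓡 m) c (π g)) (horizontalLift_spec B hH _ g).2).trans ?_
  exact mfderiv_coord_symm_apply hc hg w

theorem coordDeriv_horizontalLift (B : GroupBundle m N π) (hH : IsConnection m N π H)
    (hc : c ∈ IsManifold.maximalAtlas (𝓡 m) ∞ M) {g : G} (hg : π g ∈ c.source) (i : Fin m) :
    coordDeriv N π c g (horizontalLift π H (coordField c i) g) = EuclideanSpace.single i (1 : ℝ) :=
  coordDeriv_lift B hH hc hg (EuclideanSpace.single i (1 : ℝ))

theorem eq_horizontalLift_of_coordDeriv (B : GroupBundle m N π) (hH : IsConnection m N π H)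
    (hc : c ∈ IsManifold.maximalAtlas (𝓡 m) ∞ M) {g : G} (hg : π g ∈ c.source) (i : Fin m)
    {v : TangentSpace (𝓡 N) g} (hv : v ∈ H g)
    (h : coordDeriv N π c g v = EuclideanSpace.single i (1 : ℝ)) :
    v = horizontalLift π H (coordField c i) g := by
  refine horizontalLift_unique B hH _ g v hv ?_
  rw [coordDeriv_apply B hc hg] at h
  rw [coordField, ← h]
  have h' := (mdifferentiable_of_mem_maximalAtlas hc).symm_comp_deriv hg
  exact (DFunLike.congr_fun h' _).symm

theorem contMDiffOn_coordDeriv_apply (B : GroupBundle m N π) (hc : c ∈ IsManifold.maximalAtlas (𝓡 m) ∞ M)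
    {Y : ∀ g : G, TangentSpace (𝓡 N) g} {V : Set G}
    (hY : ContMDiffOn (𝓡 N) (𝓡 N).tangent ∞ (fun g => (⟨g, Y g⟩ : TangentBundle (𝓡 N) G)) V) :
    ContMDiffOn (𝓡 N) (𝓡 m) ∞ (fun g => coordDeriv N π c g (Y g)) (V ∩ π ⁻¹' c.source) := by
  have : IsManifold (𝓡 N) 1 G := .of_le (n := ∞) (by norm_cast)
  have hW : IsOpen (π ⁻¹' c.source) := isOpen_preimage_source B
  have h1 := (contMDiffOn_coord B hc).contMDiffOn_tangentMapWithin (m := ∞) (by norm_cast)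
    hW.uniqueMDiffOn
  have h2 := h1.comp (hY.mono (inter_subset_left (t := π ⁻¹' c.source))) (fun g hg => hg.2)
  have h3 := (contMDiff_snd_tangentBundle_modelSpace (n := ∞) (EuclideanSpace ℝ (Fin m))
    (𝓡 m)).comp_contMDiffOn h2
  refine h3.congr fun g hg => ?_
  exact DFunLike.congr_fun (mfderivWithin_of_isOpen (I := 𝓡 N) (I' := 𝓡 m) (f := c ∘ π)
    hW hg.2).symm (Y g)

/-- In a local frame `Y` of the distribution, `coordDeriv` becomes a smooth square matrix `A`. It is
onto because every vector has a horizontal lift in the span of the frame, hence it is invertible.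
The lift has coefficients `A⁻¹ eᵢ`, which are smooth because inversion of operators is. -/
theorem contMDiffOn_horizontalLift (B : GroupBundle m N π) (hH : IsConnection m N π H)
    (hc : c ∈ IsManifold.maximalAtlas (𝓡 m) ∞ M) (i : Fin m) :
    ContMDiffOn (𝓡 N) (𝓡 N).tangent ∞
      (fun g => (⟨g, horizontalLift π H (coordField c i) g⟩ : TangentBundle (𝓡 N) G))
      (π ⁻¹' c.source) := by
  have : IsManifold (𝓡 N) 1 G := .of_le (n := ∞) (by norm_cast)
  intro g₀ hg₀
  refine ContMDiffAt.contMDiffWithinAt ?_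
  obtain ⟨V, hV, hgV, Y, hY, hspan⟩ := hH.smooth g₀
  set O := V ∩ π ⁻¹' c.source with hO
  have hOo : IsOpen O := hV.inter (isOpen_preimage_source B)
  set A : G → EuclideanSpace ℝ (Fin m) →L[ℝ] EuclideanSpace ℝ (Fin m) := fun g =>
    ∑ j, (EuclideanSpace.proj j : EuclideanSpace ℝ (Fin m) →L[ℝ] ℝ).smulRight
      (coordDeriv N π c g (Y j g)) with hA
  have hAapply : ∀ g a, A g a = coordDeriv N π c g (∑ j, a j • Y j g) := by
    intro g a
    simp [hA, map_sum, map_smul]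
  have hAs : ContMDiffOn (𝓡 N) 𝓘(ℝ, EuclideanSpace ℝ (Fin m) →L[ℝ] EuclideanSpace ℝ (Fin m)) ∞
      A O := by
    refine contMDiffOn_finsetSum fun j _ => ?_
    have h := contMDiffOn_coordDeriv_apply B hc (hY j)
    exact (((ContinuousLinearMap.smulRightL ℝ (EuclideanSpace ℝ (Fin m)) (EuclideanSpace ℝ (Fin m)))
      (EuclideanSpace.proj j)).contMDiff).comp_contMDiffOn h
  have hAu : ∀ g ∈ O, IsUnit (A g) := by
    intro g hg
    rw [ContinuousLinearMap.isUnit_iff_isUnit_toLinearMap, LinearMap.isUnit_iff_range_eq_top,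
      LinearMap.range_eq_top]
    intro w
    have hmem := (horizontalLift_spec B hH (fun q => mfderiv (𝓡 m) (𝓡 m) c.symm (c q) w) g).1
    rw [hspan g hg.1] at hmem
    obtain ⟨a, ha⟩ := (Submodule.mem_span_range_iff_exists_fun ℝ).1 hmem
    refine ⟨WithLp.toLp 2 a, ?_⟩
    refine (hAapply g _).trans ?_
    refine (congrArg (coordDeriv N π c g) ha).trans ?_
    exact coordDeriv_lift B hH hc hg.2 w
  set a : G → EuclideanSpace ℝ (Fin m) := fun g =>
    Ring.inverse (A g) (EuclideanSpace.single i (1 : ℝ)) with ha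
  have has : ContMDiffAt (𝓡 N) (𝓡 m) ∞ a g₀ := by
    obtain ⟨u, hu⟩ := hAu g₀ ⟨hgV, hg₀⟩
    have h1 : ContDiffAt ℝ ∞ Ring.inverse (A g₀) := by
      rw [← hu]; exact contDiffAt_ringInverse ℝ u
    have h2 := h1.contMDiffAt.comp g₀ (hAs.contMDiffAt (hOo.mem_nhds ⟨hgV, hg₀⟩))
    exact ((ContinuousLinearMap.apply ℝ (EuclideanSpace ℝ (Fin m))
      (EuclideanSpace.single i (1 : ℝ))).contMDiff.contMDiffAt).comp g₀ h2
  have hsec : ContMDiffAt (𝓡 N) (𝓡 N).tangent ∞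
      (fun g => (⟨g, ∑ j, a g j • Y j g⟩ : TangentBundle (𝓡 N) G)) g₀ := by
    refine ContMDiffAt.sum_section fun j _ => ?_
    refine ContMDiffAt.smul_section (f := fun g => a g j) ?_ ((hY j).contMDiffAt (hV.mem_nhds hgV))
    exact ((EuclideanSpace.proj j :
      EuclideanSpace ℝ (Fin m) →L[ℝ] ℝ).contMDiff.contMDiffAt).comp g₀ has
  refine hsec.congr_of_eventuallyEq ?_
  filter_upwards [hOo.mem_nhds ⟨hgV, hg₀⟩] with g hg
  congr 1
  refine (eq_horizontalLift_of_coordDeriv B hH hc hg.2 i ?_ ?_).symm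
  · rw [hspan g hg.1]
    exact Submodule.sum_mem _ fun j _ => Submodule.smul_mem _ _ (Submodule.subset_span ⟨j, rfl⟩)
  · rw [← hAapply]
    have := Ring.mul_inverse_cancel _ (hAu g hg)
    exact DFunLike.congr_fun this (EuclideanSpace.single i (1 : ℝ))

end Lift

/-! ### Flows of lifts: action on coordinates and on products -/

section LiftFlow

variable {m N : ℕ} {M G : Type*}
  [TopologicalSpace M] [ChartedSpace (EuclideanSpace ℝ (Fin m)) M]
  [TopologicalSpace G] [ChartedSpace (EuclideanSpace ℝ (Fin N)) G]
  {π : G → M} {c : OpenPartialHomeomorph M (EuclideanSpace ℝ (Fin m))}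

/-- The flow relation of the horizontal lift of the `i`-th coordinate field of `c`. -/
abbrev LiftFlowsTo (π : G → M) (H : ∀ g : G, Submodule ℝ (TangentSpace (𝓡 N) g))
    (c : OpenPartialHomeomorph M (EuclideanSpace ℝ (Fin m))) (i : Fin m) (t : ℝ) (g g' : G) : Prop :=
  FlowsTo (horizontalLift π H (coordField c i)) (π ⁻¹' c.source) t g g'

theorem hasDerivAt_coord_comp (B : GroupBundle m N π)
    (hc : c ∈ IsManifold.maximalAtlas (𝓡 m) ∞ M) {η : ℝ → G} {r : ℝ} (hr : π (η r) ∈ c.source)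
    {v : TangentSpace (𝓡 N) (η r)}
    (hd : HasMFDerivAt 𝓘(ℝ, ℝ) (𝓡 N) η r ((1 : ℝ →L[ℝ] ℝ).smulRight v)) :
    HasDerivAt (fun s => c (π (η s))) (coordDeriv N π c (η r) v) r := by
  have h1 : HasMFDerivAt 𝓘(ℝ, ℝ) (𝓡 m) (fun s => c (π (η s))) r
      ((1 : ℝ →L[ℝ] ℝ).smulRight (coordDeriv N π c (η r) v)) :=
    ((hasMFDerivAt_coord B hc hr).comp r hd).congr_mfderiv
      (SmoothFlow.comp_smulRight_one (F := EuclideanSpace ℝ (Fin N))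
        (F' := EuclideanSpace ℝ (Fin m)) _ _)
  have h2 : HasFDerivAt (fun s => c (π (η s)))
      ((1 : ℝ →L[ℝ] ℝ).smulRight (coordDeriv N π c (η r) v)) r := hasMFDerivAt_iff_hasFDerivAt.1 h1
  exact h2.hasDerivAt.congr_deriv (by simp)

variable [IsManifold (𝓡 N) ∞ G] {H : ∀ g : G, Submodule ℝ (TangentSpace (𝓡 N) g)}

theorem hasDerivAt_coord_of_integralCurve (B : GroupBundle m N π) (hH : IsConnection m N π H)
    (hc : c ∈ IsManifold.maximalAtlas (𝓡 m) ∞ M) {i : Fin m} {γ : ℝ → G} {a b t : ℝ}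
    (hm : MapsTo γ (Ioo a b) (π ⁻¹' c.source))
    (hγ : IsMIntegralCurveOn γ (horizontalLift π H (coordField c i)) (Ioo a b))
    (ht : t ∈ Ioo a b) :
    HasDerivAt (fun s => c (π (γ s))) (EuclideanSpace.single i (1 : ℝ)) t := by
  rw [← coordDeriv_horizontalLift B hH hc (hm ht) i]
  exact hasDerivAt_coord_comp B hc (hm ht) ((hγ t ht).hasMFDerivAt (Ioo_mem_nhds ht.1 ht.2))

theorem coord_of_integralCurve (B : GroupBundle m N π) (hH : IsConnection m N π H)
    (hc : c ∈ IsManifold.maximalAtlas (𝓡 m) ∞ M) {i : Fin m} {γ : ℝ → G} {a b s t : ℝ}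
    (hm : MapsTo γ (Ioo a b) (π ⁻¹' c.source))
    (hγ : IsMIntegralCurveOn γ (horizontalLift π H (coordField c i)) (Ioo a b))
    (hs : s ∈ Ioo a b) (ht : t ∈ Ioo a b) :
    c (π (γ t)) = c (π (γ s)) + EuclideanSpace.single i (t - s) := by
  have hd : ∀ r ∈ Ioo a b, HasDerivAt
      (fun r => c (π (γ r)) - r • EuclideanSpace.single i (1 : ℝ)) 0 r := by
    intro r hr
    exact ((hasDerivAt_coord_of_integralCurve B hH hc hm hγ hr).fun_sub
      ((hasDerivAt_id r).smul_const (EuclideanSpace.single i (1 : ℝ)))).congr_deriv (by simp)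
  have h := isOpen_Ioo.is_const_of_deriv_eq_zero isPreconnected_Ioo
    (fun r hr => (hd r hr).differentiableAt.differentiableWithinAt)
    (fun r hr => (hd r hr).deriv) ht hs
  have hsingle : EuclideanSpace.single i (t - s) = (t - s) • EuclideanSpace.single i (1 : ℝ) := by
    ext j; simp
  rw [hsingle, sub_smul, ← sub_eq_zero]
  rw [← sub_eq_zero] at h
  rw [← h]
  abel

theorem LiftFlowsTo.coord (B : GroupBundle m N π) (hH : IsConnection m N π H)
    (hc : c ∈ IsManifold.maximalAtlas (𝓡 m) ∞ M) {i : Fin m} {t : ℝ} {g g' : G}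
    (h : LiftFlowsTo π H c i t g g') :
    c (π g') = c (π g) + EuclideanSpace.single i t := by
  obtain ⟨γ, a, b, h0, ht, hm, hγ, rfl, rfl⟩ := h
  simpa using coord_of_integralCurve B hH hc hm hγ h0 ht

/-- A horizontal vector is determined by its projection. A horizontal curve over the projection of
an integral curve thus has the velocity of the lift. -/
theorem isMIntegralCurveOn_lift (B : GroupBundle m N π) (hH : IsConnection m N π H)
    (hc : c ∈ IsManifold.maximalAtlas (𝓡 m) ∞ M) {i : Fin m} {γ η : ℝ → G} {a b : ℝ}
    (hm : MapsTo γ (Ioo a b) (π ⁻¹' c.source))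
    (hγ : IsMIntegralCurveOn γ (horizontalLift π H (coordField c i)) (Ioo a b))
    (hπ : ∀ r ∈ Ioo a b, π (η r) = π (γ r))
    (hη : ∀ r ∈ Ioo a b, ∃ v ∈ H (η r), HasMFDerivWithinAt 𝓘(ℝ, ℝ) (𝓡 N) η (Ioo a b) r
      ((1 : ℝ →L[ℝ] ℝ).smulRight v)) :
    IsMIntegralCurveOn η (horizontalLift π H (coordField c i)) (Ioo a b) := by
  intro r hr
  obtain ⟨v, hv, hd⟩ := hη r hr
  have hsrc : π (η r) ∈ c.source := by rw [hπ r hr]; exact hm hr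
  suffices h : v = horizontalLift π H (coordField c i) (η r) by rw [← h]; exact hd
  refine eq_horizontalLift_of_coordDeriv B hH hc hsrc i hv ?_
  have h3 := hasDerivAt_coord_comp B hc hsrc (hd.hasMFDerivAt (Ioo_mem_nhds hr.1 hr.2))
  have h4 : HasDerivAt (fun s => c (π (η s))) (EuclideanSpace.single i (1 : ℝ)) r := by
    refine (hasDerivAt_coord_of_integralCurve B hH hc hm hγ hr).congr_of_eventuallyEq ?_
    filter_upwards [Ioo_mem_nhds hr.1 hr.2] with s hs
    rw [hπ s hs]
  exact h3.unique h4

/-- The coordinates of both projections grow by `r` in direction `i` from the same start, so the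
curves can be multiplied pointwise. Compatibility of the connection with multiplication makes the
product curve horizontal. -/
theorem LiftFlowsTo.mul {B : GroupBundle m N π} (hH : IsGroupConnection B H)
    (hc : c ∈ IsManifold.maximalAtlas (𝓡 m) ∞ M) {i : Fin m} {t : ℝ} {g g' h h' : G}
    (hg : LiftFlowsTo π H c i t g g') (hh : LiftFlowsTo π H c i t h h') (hgh : π g = π h) :
    LiftFlowsTo π H c i t (B.mul g h) (B.mul g' h') := by
  obtain ⟨γ, a, b, h0, ht, hm, hγ, rfl, rfl⟩ := hg
  obtain ⟨γ', a', b', h0', ht', hm', hγ', rfl, rfl⟩ := hh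
  set I := Ioo (max a a') (min b b') with hI
  have hi : I = Ioo a b ∩ Ioo a' b' := Ioo_inter_Ioo.symm
  have hIm : MapsTo γ I (π ⁻¹' c.source) := by rw [hi]; exact hm.mono_left inter_subset_left
  have hIm' : MapsTo γ' I (π ⁻¹' c.source) := by rw [hi]; exact hm'.mono_left inter_subset_right
  have hIγ := hγ.mono (hi.le.trans inter_subset_left)
  have hIγ' := hγ'.mono (hi.le.trans inter_subset_right)
  have h0I : (0 : ℝ) ∈ I := by rw [hi]; exact ⟨h0, h0'⟩
  have htI : t ∈ I := by rw [hi]; exact ⟨ht, ht'⟩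
  have hπ : ∀ r ∈ I, π (γ r) = π (γ' r) := by
    intro r hr
    refine c.injOn (hIm hr) (hIm' hr) ?_
    rw [coord_of_integralCurve B hH.toIsConnection hc hIm hIγ h0I hr,
      coord_of_integralCurve B hH.toIsConnection hc hIm' hIγ' h0I hr, hgh]
  have hπm : ∀ r ∈ I, π (B.mul (γ r) (γ' r)) = π (γ r) := fun r hr => B.proj_mul _ _ (hπ r hr)
  refine ⟨fun r => B.mul (γ r) (γ' r), max a a', min b b', h0I, htI, ?_, ?_, rfl, rfl⟩
  · intro r hr
    rw [mem_preimage, hπm r hr]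
    exact hIm hr
  · refine isMIntegralCurveOn_lift B hH.toIsConnection hc hIm hIγ hπm ?_
    intro r hr
    refine ⟨dMul B (γ r) (γ' r) (horizontalLift π H (coordField c i) (γ r),
      horizontalLift π H (coordField c i) (γ' r)), ?_, ?_⟩
    · have hsub := (hH.map_mul (γ r) (γ' r) (hπ r hr)).le
      refine hsub ⟨_, ⟨(horizontalLift_spec B hH.toIsConnection _ _).1,
        (horizontalLift_spec B hH.toIsConnection _ _).1, ?_⟩, rfl⟩
      refine (horizontalLift_spec B hH.toIsConnection (coordField c i) (γ r)).2.trans ?_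
      refine Eq.trans ?_ (horizontalLift_spec B hH.toIsConnection (coordField c i) (γ' r)).2.symm
      exact congrArg (fun q => (coordField c i q : EuclideanSpace ℝ (Fin m))) (hπ r hr)
    · have hd := ((B.smooth_mul (γ r, γ' r) (hπ r hr)).mdifferentiableWithinAt
        (by simp)).hasMFDerivWithinAt
      have hp : HasMFDerivWithinAt 𝓘(ℝ, ℝ) ((𝓡 N).prod (𝓡 N)) (fun r => (γ r, γ' r)) I r _ :=
        (hIγ r hr).prodMk (hIγ' r hr)
      have hsub : I ⊆ (fun r => (γ r, γ' r)) ⁻¹' fiberProduct π := fun s hs => hπ s hs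
      have hcomp := hd.comp r hp hsub
      refine hcomp.congr_mfderiv ?_
      exact SmoothFlow.comp_prod_smulRight_one (F₁ := EuclideanSpace ℝ (Fin N))
        (F₂ := EuclideanSpace ℝ (Fin N)) (F' := EuclideanSpace ℝ (Fin N)) _ _ _

end LiftFlow

/-! ### Completeness of the lifts over the coordinate domain -/

section Completeness

variable {m N : ℕ} {M G : Type*}
  [TopologicalSpace M] [ChartedSpace (EuclideanSpace ℝ (Fin m)) M]
  [TopologicalSpace G] [ChartedSpace (EuclideanSpace ℝ (Fin N)) G]
  {π : G → M} {c : OpenPartialHomeomorph M (EuclideanSpace ℝ (Fin m))}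

theorem single_add (i : Fin m) (s t : ℝ) : EuclideanSpace.single i (s + t) =
    EuclideanSpace.single i s + EuclideanSpace.single i t := by
  ext j
  by_cases h : j = i <;> simp [h]

theorem GroupBundle.mul_inv_mul_cancel (B : GroupBundle m N π) {g h : G} (hgh : π g = π h) :
    B.mul g (B.mul (B.inv g) h) = h := by
  rw [← B.mul_assoc _ _ _ (B.proj_inv g).symm (by rw [B.proj_inv, hgh]), B.mul_inv, hgh, B.one_mul]

variable [IsManifold (𝓡 N) ∞ G] {H : ∀ g : G, Submodule ℝ (TangentSpace (𝓡 N) g)}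

/-- Elements of a fibre near the unit flow for a uniform time, and the elements that flow for a
given time form a subgroup; so flowing for a short time is a locally constant property on fibres. -/
theorem eventually_exists_flow_of_isPreconnected {B : GroupBundle m N π}
    (hH : IsGroupConnection B H) (hc : c ∈ IsManifold.maximalAtlas (𝓡 m) ∞ M) (i : Fin m) {q : M}
    (hq : q ∈ c.source) :
    ∃ δ > 0, ∀ᶠ x in 𝓝 q, ∀ s ∈ Ioo (-δ) δ, ∀ S ⊆ π ⁻¹' {x}, IsPreconnected S →
      ∀ g ∈ S, ∀ h ∈ S, (∃ g', LiftFlowsTo π H c i s g g') → ∃ h', LiftFlowsTo π H c i s h h' := by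
  have hY := contMDiffOn_horizontalLift B hH.toIsConnection hc i
  have hone : B.one q ∈ π ⁻¹' c.source := by rw [mem_preimage, B.proj_one]; exact hq
  obtain ⟨δ, hδ, V, hV, hqV, -, φ, -, hφ⟩ :=
    SmoothFlow.exists_contMDiffOn_flow (isOpen_preimage_source B) hY hone
  have hflow : ∀ k ∈ V, ∀ s ∈ Ioo (-δ) δ, ∃ k', LiftFlowsTo π H c i s k k' := by
    intro k hk s hs
    obtain ⟨h1, h2, h3⟩ := hφ k hk
    refine ⟨φ (k, s), ?_⟩
    have := FlowsTo.of_curve h3 h2 (s := 0) (by simp [hδ]) hs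
    rwa [h1, sub_zero] at this
  refine ⟨δ, hδ, ?_⟩
  filter_upwards [B.smooth_one.continuous.continuousAt.eventually (hV.mem_nhds hqV)]
    with x hx s hs S hS hpre g hg h hh
  have hfib : ∀ g ∈ S, π g = x := fun g hg => hS hg
  -- Here `h = g (g⁻¹ h)` is a product of an element that flows by assumption and one near the unit,
  -- which flows for every time below `δ`.
  have hmul : ∀ g ∈ S, ∀ h ∈ S, B.mul (B.inv g) h ∈ V → (∃ g', LiftFlowsTo π H c i s g g') →
      ∃ h', LiftFlowsTo π H c i s h h' := by
    rintro g hg h hh hgh ⟨g', hg'⟩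
    obtain ⟨k', hk'⟩ := hflow _ hgh s hs
    have hπ : π g = π h := (hfib g hg).trans (hfib h hh).symm
    have := hg'.mul hH hc hk' (by rw [B.proj_mul _ _ (by rw [B.proj_inv, hπ]), B.proj_inv])
    rw [B.mul_inv_mul_cancel hπ] at this
    exact ⟨_, this⟩
  have hcont : ∀ g ∈ S, ∀ᶠ h in 𝓝[S] g, B.mul (B.inv g) h ∈ V ∧ B.mul (B.inv h) g ∈ V := by
    intro g hg
    have hval : B.mul (B.inv g) g ∈ V := by rw [B.inv_mul, hfib g hg]; exact hx
    have hmc : ContinuousWithinAt (fun p : G × G => B.mul p.1 p.2) (fiberProduct π) (B.inv g, g) :=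
      B.smooth_mul.continuousOn _ (B.proj_inv g)
    have e := hmc.eventually (hV.mem_nhds hval)
    have hic : ContinuousWithinAt B.inv S g := B.smooth_inv.continuous.continuousWithinAt
    have t1 : Tendsto (fun h => (B.inv g, h)) (𝓝[S] g) (𝓝[fiberProduct π] (B.inv g, g)) := by
      refine tendsto_nhdsWithin_iff.2 ⟨?_, ?_⟩
      · exact tendsto_const_nhds.prodMk_nhds (tendsto_id.mono_left nhdsWithin_le_nhds)
      · filter_upwards [self_mem_nhdsWithin] with h hh
        exact (B.proj_inv g).trans ((hfib g hg).trans (hfib h hh).symm)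
    have t2 : Tendsto (fun h => (B.inv h, g)) (𝓝[S] g) (𝓝[fiberProduct π] (B.inv g, g)) := by
      refine tendsto_nhdsWithin_iff.2 ⟨hic.prodMk_nhds tendsto_const_nhds, ?_⟩
      filter_upwards [self_mem_nhdsWithin] with h hh
      exact (B.proj_inv h).trans ((hfib h hh).trans (hfib g hg).symm)
    exact (t1.eventually e).and (t2.eventually e)
  refine hpre.induction₂' (fun g h => (∃ g', LiftFlowsTo π H c i s g g') →
    ∃ h', LiftFlowsTo π H c i s h h') ?_ (fun _ _ _ _ _ _ h1 h2 h => h2 (h1 h)) hg hh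
  intro g hg
  filter_upwards [hcont g hg, self_mem_nhdsWithin] with h hgh hh
  exact ⟨hmul g hg h hh hgh.1, hmul h hh g hg hgh.2⟩

variable [T2Space G]

/-- Extending the curve to the endpoint needs an element of a late fibre that reaches the limit
fibre over `q` and lies in a connected set with the curve. A trivialization near `q` projects the
tail of the curve to a connected set in the fibre over `q`. The backward flow from any point `f` of
this set supplies the element. -/
theorem exists_liftFlowsTo_of_forall_lt {B : GroupBundle m N π} (hH : IsGroupConnection B H)
    (hc : c ∈ IsManifold.maximalAtlas (𝓡 m) ∞ M) (i : Fin m) {g : G}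
    {T r : ℝ} (hr : 0 < r)
    (hT : c (π g) + EuclideanSpace.single i (r * T) ∈ c.target)
    (h : ∀ s ∈ Ico 0 r, ∃ g', LiftFlowsTo π H c i (s * T) g g') :
    ∃ g', LiftFlowsTo π H c i (r * T) g g' := by
  have hY := contMDiffOn_horizontalLift B hH.toIsConnection hc i
  have hW : IsOpen (π ⁻¹' c.source) := isOpen_preimage_source B
  set x : ℝ → M := fun s => c.symm (c (π g) + EuclideanSpace.single i (s * T)) with hx
  set q : M := x r with hq
  have hqs : q ∈ c.source := c.map_target hT
  have hcq : c q = c (π g) + EuclideanSpace.single i (r * T) := c.right_inv hT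
  have hsingle : Continuous (fun s : ℝ => c (π g) + EuclideanSpace.single i (s * T)) := by
    refine continuous_const.add ?_
    exact (PiLp.continuous_toLp 2 _).comp
      ((continuous_single i).comp (continuous_id.mul continuous_const))
  have hxc : ContinuousAt x r :=
    ContinuousAt.comp (g := c.symm) (c.continuousAt_symm hT) hsingle.continuousAt
  obtain ⟨U, hU, hqU, Φ, Ψ, hΦ⟩ := B.smooth_bundle q
  obtain ⟨δ, hδ, hev⟩ := eventually_exists_flow_of_isPreconnected hH hc i hqs
  have : Nonempty G := ⟨g⟩
  choose! σ hσ using h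
  have hσπ : ∀ s ∈ Ico 0 r, π (σ s) = x s := by
    intro s hs
    have h1 := (hσ s hs).coord B hH.toIsConnection hc
    have h2 : π (σ s) ∈ c.source := (hσ s hs).mem_right
    rw [hx]
    simp only
    rw [← h1, c.left_inv h2]
  have hσc : ContinuousOn σ (Ico 0 r) := by
    intro s hs
    obtain ⟨γ, a, b, h0, ht, hm, hγ, hγ0, hγt⟩ := hσ s hs
    have hγc : ContinuousAt (fun u => γ (u * T)) s :=
      ContinuousAt.comp (g := γ) ((hγ.continuousWithinAt ht).continuousAt (Ioo_mem_nhds ht.1 ht.2))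
        (continuous_id.mul continuous_const).continuousAt
    refine hγc.continuousWithinAt.congr_of_eventuallyEq ?_ hγt.symm
    have hn : ∀ᶠ u in 𝓝 s, u * T ∈ Ioo a b :=
      (continuous_id.mul continuous_const).continuousAt.eventually (isOpen_Ioo.mem_nhds ht)
    filter_upwards [nhdsWithin_le_nhds hn, self_mem_nhdsWithin] with u hu hu'
    refine (hσ u hu').unique hW hY ?_
    have := FlowsTo.of_curve hγ hm h0 hu
    rwa [hγ0, sub_zero] at this
  have hnear : ∀ᶠ s in 𝓝 r, x s ∈ U ∧ (r - s) * T ∈ Ioo (-δ) δ ∧ 0 < s ∧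
      (∀ u ∈ Ioo (-δ) δ, ∀ S ⊆ π ⁻¹' {x s}, IsPreconnected S → ∀ g ∈ S, ∀ h ∈ S,
        (∃ g', LiftFlowsTo π H c i u g g') → ∃ h', LiftFlowsTo π H c i u h h') := by
    have e1 : ∀ᶠ s in 𝓝 r, (r - s) * T ∈ Ioo (-δ) δ := by
      have hcont : Continuous (fun s : ℝ => (r - s) * T) := by fun_prop
      exact hcont.continuousAt.eventually (isOpen_Ioo.mem_nhds (by simp [hδ]))
    exact (hxc.eventually (hU.mem_nhds hqU)).and (e1.and ((lt_mem_nhds hr).and (hxc.eventually hev)))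
  obtain ⟨r₁, hr₁, hr₁'⟩ := exists_Ioc_subset_of_mem_nhds hnear ⟨0, hr⟩
  have hUmem : ∀ s ∈ Ioo r₁ r, s ∈ Ico 0 r ∧ π (σ s) ∈ U := by
    intro s hs
    have hs' := hr₁' ⟨hs.1, hs.2.le⟩
    have h0 : s ∈ Ico 0 r := ⟨hs'.2.2.1.le, hs.2⟩
    exact ⟨h0, by rw [hσπ s h0]; exact hs'.1⟩
  set A : Set G := (fun s => (Φ (σ s)).2) '' Ioo r₁ r with hA
  have hΦc : ContinuousOn (fun g => (Φ g).2) (π ⁻¹' U) :=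
    continuous_snd.comp_continuousOn hΦ.smooth.continuousOn
  have hApre : IsPreconnected A := by
    refine isPreconnected_Ioo.image _ (hΦc.comp (hσc.mono fun s hs => (hUmem s hs).1) ?_)
    exact fun s hs => (hUmem s hs).2
  have hAsub : A ⊆ π ⁻¹' {q} := by
    rintro _ ⟨s, hs, rfl⟩
    exact (hΦ.mapsTo (hUmem s hs).2).2
  have hr₂ : (r₁ + r) / 2 ∈ Ioo r₁ r := ⟨by linarith, by linarith⟩
  -- Any point of `A` would do; the midpoint of the time interval selects one.
  set f : G := (Φ (σ ((r₁ + r) / 2))).2 with hf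
  have hfA : f ∈ A := ⟨_, hr₂, rfl⟩
  have hqf : (q, f) ∈ U ×ˢ (π ⁻¹' {q}) := ⟨hqU, hAsub hfA⟩
  have hΦΨ : Φ (Ψ (q, f)) = (q, f) := hΦ.invOn.2 hqf
  have hπΨ : π (Ψ (q, f)) = q := by
    rw [← hΦ.fiber_preserving _ (hΦ.mapsTo_inv hqf), hΦΨ]
  obtain ⟨ε, hε, V, hV, hfV, -, φ, -, hφ⟩ :=
    SmoothFlow.exists_contMDiffOn_flow hW hY (x₀ := Ψ (q, f)) (by rw [mem_preimage, hπΨ]; exact hqs)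
  obtain ⟨τ, hτ0, hτm, hτ⟩ : ∃ τ : ℝ → G, τ 0 = Ψ (q, f) ∧
      MapsTo τ (Ioo (-ε) ε) (π ⁻¹' c.source) ∧
      IsMIntegralCurveOn τ (horizontalLift π H (coordField c i)) (Ioo (-ε) ε) :=
    ⟨fun t => φ (Ψ (q, f), t), hφ _ hfV⟩
  have h0ε : (0 : ℝ) ∈ Ioo (-ε) ε := by simp [hε]
  have hnear2 : ∀ᶠ s in 𝓝 r, (s - r) * T ∈ Ioo (-ε) ε := by
    have hcont : Continuous (fun s : ℝ => (s - r) * T) := by fun_prop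
    exact hcont.continuousAt.eventually (isOpen_Ioo.mem_nhds (by simp [hε]))
  obtain ⟨r₃, hr₃, hr₃'⟩ := exists_Ioc_subset_of_mem_nhds' hnear2 hr₁
  have hτπ : ∀ s ∈ Ioc r₃ r, π (τ ((s - r) * T)) = x s := by
    intro s hs
    have h1 := coord_of_integralCurve B hH.toIsConnection hc hτm hτ h0ε (hr₃' hs)
    have h2 : π (τ ((s - r) * T)) ∈ c.source := hτm (hr₃' hs)
    rw [hτ0, hπΨ, hcq, sub_zero, add_assoc, ← single_add] at h1
    rw [hx, ← c.left_inv h2, h1]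
    congr 3
    ring
  have hUτ : ∀ s ∈ Ioc r₃ r, π (τ ((s - r) * T)) ∈ U := by
    intro s hs
    rw [hτπ s hs]
    exact (hr₁' ⟨hr₃.1.trans_lt hs.1, hs.2⟩).1
  set A' : Set G := (fun s => (Φ (τ ((s - r) * T))).2) '' Ioc r₃ r with hA'
  have hApre' : IsPreconnected A' := by
    refine isPreconnected_Ioc.image _ (ContinuousOn.comp (g := fun g => (Φ g).2)
      (f := fun s => τ ((s - r) * T)) hΦc ?_ hUτ)
    exact hτ.continuousOn.comp (by fun_prop) hr₃'
  have hAsub' : A' ⊆ π ⁻¹' {q} := by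
    rintro _ ⟨s, hs, rfl⟩
    exact (hΦ.mapsTo (hUτ s hs)).2
  have hfA' : f ∈ A' := ⟨r, ⟨hr₃.2, le_rfl⟩, by simp only [sub_self, zero_mul, hτ0, hΦΨ]⟩
  set r₄ := (r₃ + r) / 2 with hr₄
  have hr₄m : r₄ ∈ Ioc r₃ r := ⟨by linarith [hr₃.2], by linarith [hr₃.2]⟩
  have hr₄m' : r₄ ∈ Ioo r₁ r := ⟨hr₃.1.trans_lt hr₄m.1, by linarith [hr₃.2]⟩
  obtain ⟨hxU, hrδ, -, hC⟩ := hr₁' ⟨hr₄m'.1, hr₄m.2⟩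
  have hfib : ∀ k ∈ A ∪ A', (x r₄, k) ∈ U ×ˢ (π ⁻¹' {q}) :=
    fun k hk => ⟨hxU, hk.elim (fun h => hAsub h) (fun h => hAsub' h)⟩
  -- `A` and `A'` share `f`, so their union is connected. Moved to the fibre over `x r₄`, it
  -- contains both `σ r₄` and the point of `τ` at that time, the latter being known to flow to the
  -- limit fibre.
  set S : Set G := (fun k => Ψ (x r₄, k)) '' (A ∪ A') with hS
  have hSpre : IsPreconnected S := by
    refine (hApre.union f hfA hfA' hApre').image _ ?_
    exact hΦ.smooth_inv.continuousOn.comp (by fun_prop) hfib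
  have hSsub : S ⊆ π ⁻¹' {x r₄} := by
    rintro _ ⟨k, hk, rfl⟩
    change π _ = _
    rw [← hΦ.fiber_preserving _ (hΦ.mapsTo_inv (hfib k hk)), hΦ.invOn.2 (hfib k hk)]
  have hback : ∀ k ∈ π ⁻¹' U, π k = x r₄ → Ψ (x r₄, (Φ k).2) = k := by
    intro k hk hkx
    rw [← hkx, ← hΦ.fiber_preserving k hk]
    exact hΦ.invOn.1 hk
  have hσS : σ r₄ ∈ S :=
    ⟨_, Or.inl ⟨r₄, hr₄m', rfl⟩, hback _ (hUmem _ hr₄m').2 (hσπ _ (hUmem _ hr₄m').1)⟩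
  have hτS : τ ((r₄ - r) * T) ∈ S :=
    ⟨_, Or.inr ⟨r₄, hr₄m, rfl⟩, hback _ (hUτ _ hr₄m) (hτπ _ hr₄m)⟩
  have hτflow : LiftFlowsTo π H c i ((r - r₄) * T) (τ ((r₄ - r) * T)) (τ 0) := by
    have := FlowsTo.of_curve hτ hτm (hr₃' hr₄m) h0ε
    convert this using 1
    ring
  obtain ⟨g', hg'⟩ := hC _ hrδ S hSsub hSpre _ hτS _ hσS ⟨_, hτflow⟩
  refine ⟨g', ?_⟩
  have := (hσ _ (hUmem _ hr₄m').1).trans hW hY hg'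
  convert this using 1
  ring

/-- Running through times `r * T` with `r` in `[0, 1]` treats both signs of `T` at once. The
attainable `r` contain the supremum by the preceding lemma. They are open because integral curves
live on open intervals, so the supremum is `1`. -/
theorem exists_liftFlowsTo {B : GroupBundle m N π} (hH : IsGroupConnection B H)
    (hc : c ∈ IsManifold.maximalAtlas (𝓡 m) ∞ M) (i : Fin m) {g : G} (hg : π g ∈ c.source)
    {T : ℝ} (hT : ∀ r ∈ Icc (0 : ℝ) 1, c (π g) + EuclideanSpace.single i (r * T) ∈ c.target) :
    ∃ g', LiftFlowsTo π H c i T g g' := by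
  have hY := contMDiffOn_horizontalLift B hH.toIsConnection hc i
  have hW : IsOpen (π ⁻¹' c.source) := isOpen_preimage_source B
  let P : ℝ → Prop := fun r => ∃ g', LiftFlowsTo π H c i (r * T) g g'
  have h0 : P 0 := by
    obtain ⟨ε, hε, V, hV, hgV, -, φ, -, hφ⟩ := SmoothFlow.exists_contMDiffOn_flow hW hY hg
    obtain ⟨h1, h2, h3⟩ := hφ g hgV
    refine ⟨φ (g, 0), ?_⟩
    have := FlowsTo.of_curve h3 h2 (s := 0) (t := 0) (by simp [hε]) (by simp [hε])
    rw [h1, sub_zero] at this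
    rwa [h1, zero_mul]
  have hopen : ∀ r, P r → (∀ s ∈ Icc 0 r, P s) ∧ ∀ᶠ s in 𝓝 r, P s := by
    rintro r ⟨g', γ, a, b, h0, ht, hm, hγ, hγ0, hγt⟩
    have hP : ∀ s, s * T ∈ Ioo a b → P s := by
      intro s hs
      have := FlowsTo.of_curve hγ hm h0 hs
      rw [hγ0, sub_zero] at this
      exact ⟨_, this⟩
    refine ⟨fun s hs => hP s ?_, ?_⟩
    · rcases le_total 0 T with hT0 | hT0
      · exact ⟨h0.1.trans_le (mul_nonneg hs.1 hT0),
          (mul_le_mul_of_nonneg_right hs.2 hT0).trans_lt ht.2⟩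
      · exact ⟨ht.1.trans_le (mul_le_mul_of_nonpos_right hs.2 hT0),
          (mul_nonpos_of_nonneg_of_nonpos hs.1 hT0).trans_lt h0.2⟩
    · have hcont : Continuous (fun s : ℝ => s * T) := by fun_prop
      filter_upwards [hcont.continuousAt.eventually (isOpen_Ioo.mem_nhds ht)] with s hs
      exact hP s hs
  let Q : Set ℝ := {r | r ∈ Icc 0 1 ∧ P r}
  have hQ0 : (0 : ℝ) ∈ Q := ⟨by simp, h0⟩
  have hQb : BddAbove Q := ⟨1, fun r hr => hr.1.2⟩
  set r := sSup Q with hr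
  have hr0 : 0 ≤ r := le_csSup hQb hQ0
  have hr1 : r ≤ 1 := csSup_le ⟨0, hQ0⟩ fun s hs => hs.1.2
  have hlt : ∀ s ∈ Ico 0 r, P s := by
    intro s hs
    obtain ⟨u, hu, hsu⟩ := exists_lt_of_lt_csSup ⟨0, hQ0⟩ hs.2
    exact (hopen u hu.2).1 s ⟨hs.1, hsu.le⟩
  have hPr : P r := by
    rcases hr0.eq_or_lt with h | h
    · rw [← h]; exact h0
    · exact exists_liftFlowsTo_of_forall_lt hH hc i h (hT r ⟨hr0, hr1⟩) hlt
  have hreq : r = 1 := by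
    by_contra hne
    have hlt1 : r < 1 := lt_of_le_of_ne hr1 hne
    obtain ⟨u, hu, hu'⟩ := exists_Ico_subset_of_mem_nhds (hopen r hPr).2 ⟨1, hlt1⟩
    have hmid : (r + min u 1) / 2 ∈ Ico r u :=
      ⟨by linarith [lt_min hu hlt1], by linarith [min_le_left u 1, lt_min hu hlt1]⟩
    have : (r + min u 1) / 2 ∈ Q :=
      ⟨⟨by linarith [hmid.1], by linarith [min_le_right u 1]⟩, hu' hmid⟩
    have := le_csSup hQb this
    linarith [lt_min hu hlt1]
  rw [hreq] at hPr
  obtain ⟨g', hg'⟩ := hPr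
  rw [one_mul] at hg'
  exact ⟨g', hg'⟩

end Completeness

/-! ### The trivialization over a cube as a composite of flows -/

section CubeTrivialization

variable {m N : ℕ} {M G : Type*}
  [TopologicalSpace M] [ChartedSpace (EuclideanSpace ℝ (Fin m)) M]
  [TopologicalSpace G] [ChartedSpace (EuclideanSpace ℝ (Fin N)) G]

/-- The flow of the horizontal lift of the `i`-th coordinate field, where it is defined. -/
def liftFlow (π : G → M) (H : ∀ g : G, Submodule ℝ (TangentSpace (𝓡 N) g))
    (c : OpenPartialHomeomorph M (EuclideanSpace ℝ (Fin m))) (i : Fin m) (z : G × ℝ) : G :=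
  open Classical in
  if h : ∃ g', LiftFlowsTo π H c i z.2 z.1 g' then h.choose else z.1

/-- The pairs `(g, t)` for which `c_i (π g) + t` stays in the range of the coordinate `c_i`. -/
def liftFlowDomain (π : G → M) (c : OpenPartialHomeomorph M (EuclideanSpace ℝ (Fin m)))
    (i : Fin m) : Set (G × ℝ) :=
  {z | π z.1 ∈ c.source ∧ c (π z.1) i + z.2 ∈ Ioo (-(1 / 2) : ℝ) (1 / 2)}

variable {π : G → M} {c : OpenPartialHomeomorph M (EuclideanSpace ℝ (Fin m))} {p : M}

theorem IsCubeChart.coord_mem (hc : IsCubeChart p c) {q : M} (hq : q ∈ c.source) (i : Fin m) :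
    c q i ∈ Ioo (-(1 / 2) : ℝ) (1 / 2) := by
  have := c.map_source hq
  rw [hc.2.2.2] at this
  exact this i

theorem isOpen_liftFlowDomain (B : GroupBundle m N π) (i : Fin m) :
    IsOpen (liftFlowDomain π c i) := by
  have hW : IsOpen ((fun z : G × ℝ => π z.1) ⁻¹' c.source) :=
    c.open_source.preimage (B.smooth_proj.continuous.comp continuous_fst)
  have hcont : ContinuousOn (fun z : G × ℝ => c (π z.1) i + z.2)
      ((fun z : G × ℝ => π z.1) ⁻¹' c.source) := by
    refine ContinuousOn.add ?_ continuous_snd.continuousOn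
    refine (EuclideanSpace.proj i : EuclideanSpace ℝ (Fin m) →L[ℝ] ℝ).continuous.comp_continuousOn ?_
    exact c.continuousOn.comp (B.smooth_proj.continuous.comp continuous_fst).continuousOn
      fun _ h => h
  exact hcont.isOpen_inter_preimage hW isOpen_Ioo

variable [IsManifold (𝓡 N) ∞ G] {H : ∀ g : G, Submodule ℝ (TangentSpace (𝓡 N) g)} [T2Space G]

theorem liftFlow_spec {B : GroupBundle m N π} (hH : IsGroupConnection B H) (hc : IsCubeChart p c)
    (i : Fin m) {z : G × ℝ} (hz : z ∈ liftFlowDomain π c i) :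
    LiftFlowsTo π H c i z.2 z.1 (liftFlow π H c i z) := by
  have hex : ∃ g', LiftFlowsTo π H c i z.2 z.1 g' := by
    refine exists_liftFlowsTo hH hc.1 i hz.1 fun r hr => ?_
    rw [hc.2.2.2]
    intro j
    have hj := hc.coord_mem hz.1 j
    by_cases hij : j = i
    · subst hij
      have hconv := (convex_Ioo (-(1 / 2) : ℝ) (1 / 2)) hj hz.2 (sub_nonneg.2 hr.2) hr.1 (by ring)
      simp only [smul_eq_mul] at hconv
      simp only [PiLp.add_apply, PiLp.single_apply, if_true]
      convert hconv using 1
      ring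
    · simpa [hij] using hj
  rw [liftFlow, dif_pos hex]
  exact hex.choose_spec

theorem liftFlow_eq {B : GroupBundle m N π} (hH : IsGroupConnection B H)
    (hc : c ∈ IsManifold.maximalAtlas (𝓡 m) ∞ M)
    {i : Fin m} {t : ℝ} {g g' : G} (h : LiftFlowsTo π H c i t g g') :
    liftFlow π H c i (g, t) = g' := by
  have hex : ∃ g', LiftFlowsTo π H c i (g, t).2 (g, t).1 g' := ⟨g', h⟩
  rw [liftFlow, dif_pos hex]
  exact hex.choose_spec.unique (isOpen_preimage_source B)
    (contMDiffOn_horizontalLift B hH.toIsConnection hc i) h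

theorem contMDiffOn_liftFlow {B : GroupBundle m N π} (hH : IsGroupConnection B H)
    (hc : IsCubeChart p c) (i : Fin m) :
    ContMDiffOn ((𝓡 N).prod 𝓘(ℝ, ℝ)) (𝓡 N) ∞ (liftFlow π H c i) (liftFlowDomain π c i) := by
  refine contMDiffOn_of_flowsTo (isOpen_preimage_source B)
    (contMDiffOn_horizontalLift B hH.toIsConnection hc.1 i) (isOpen_liftFlowDomain B i) ?_ ?_
    fun z hz => liftFlow_spec hH hc i hz
  · intro g
    by_cases hg : π g ∈ c.source
    · have : {t | (g, t) ∈ liftFlowDomain π c i} =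
          Ioo (-(1 / 2) - c (π g) i) (1 / 2 - c (π g) i) := by
        ext t
        simp only [liftFlowDomain, mem_ofPred_eq, hg, true_and, mem_Ioo]
        constructor <;> rintro ⟨h1, h2⟩ <;> constructor <;> linarith
      rw [this]
      exact isPreconnected_Ioo
    · have : {t | (g, t) ∈ liftFlowDomain π c i} = ∅ := by
        ext t
        simp [liftFlowDomain, hg]
      rw [this]
      exact isPreconnected_empty
  · intro g t hgt
    exact ⟨hgt.1, by simpa using hc.coord_mem hgt.1 i⟩

/-- The pairs `(q, h)` such that the first `k` coordinates of `π h` vanish and the others agree with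
those of `q`. -/
def stage (π : G → M) (c : OpenPartialHomeomorph M (EuclideanSpace ℝ (Fin m))) (k : ℕ) :
    Set (M × G) :=
  {x | x.1 ∈ c.source ∧ π x.2 ∈ c.source ∧
    ∀ j : Fin m, c (π x.2) j = if (j : ℕ) < k then 0 else c x.1 j}

/-- The flow along the `k`-th coordinate from `stage k` to `stage (k + 1)`. -/
def stepDown (π : G → M) (H : ∀ g : G, Submodule ℝ (TangentSpace (𝓡 N) g))
    (c : OpenPartialHomeomorph M (EuclideanSpace ℝ (Fin m))) (k : ℕ) (x : M × G) : M × G :=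
  if h : k < m then (x.1, liftFlow π H c ⟨k, h⟩ (x.2, -(c x.1 ⟨k, h⟩))) else x

/-- The flow along the `k`-th coordinate from `stage (k + 1)` to `stage k`. -/
def stepUp (π : G → M) (H : ∀ g : G, Submodule ℝ (TangentSpace (𝓡 N) g))
    (c : OpenPartialHomeomorph M (EuclideanSpace ℝ (Fin m))) (k : ℕ) (x : M × G) : M × G :=
  if h : k < m then (x.1, liftFlow π H c ⟨k, h⟩ (x.2, c x.1 ⟨k, h⟩)) else x

/-- The composite of the first `k` downward steps. -/
def iterDown (π : G → M) (H : ∀ g : G, Submodule ℝ (TangentSpace (𝓡 N) g))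
    (c : OpenPartialHomeomorph M (EuclideanSpace ℝ (Fin m))) : ℕ → M × G → M × G
  | 0 => id
  | k + 1 => stepDown π H c k ∘ iterDown π H c k

/-- The composite of the first `k` upward steps, in the opposite order. -/
def iterUp (π : G → M) (H : ∀ g : G, Submodule ℝ (TangentSpace (𝓡 N) g))
    (c : OpenPartialHomeomorph M (EuclideanSpace ℝ (Fin m))) : ℕ → M × G → M × G
  | 0 => id
  | k + 1 => iterUp π H c k ∘ stepUp π H c k

theorem stage_succ_of_le {k : ℕ} (hk : m ≤ k) : stage π c (k + 1) = stage π c k := by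
  ext x
  have h : ∀ j : Fin m, (j : ℕ) < k := fun j => j.2.trans_le hk
  simp [stage, h, fun j => (h j).trans (Nat.lt_succ_self k)]

theorem mem_liftFlowDomain_of_mem_stage {k : ℕ} (hk : k < m) {x : M × G}
    (hx : x ∈ stage π c k) : (x.2, -(c x.1 ⟨k, hk⟩)) ∈ liftFlowDomain π c ⟨k, hk⟩ := by
  refine ⟨hx.2.1, ?_⟩
  simp [hx.2.2 ⟨k, hk⟩]

theorem mem_liftFlowDomain_of_mem_stage_succ (hc : IsCubeChart p c) {k : ℕ} (hk : k < m)
    {x : M × G} (hx : x ∈ stage π c (k + 1)) :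
    (x.2, c x.1 ⟨k, hk⟩) ∈ liftFlowDomain π c ⟨k, hk⟩ := by
  refine ⟨hx.2.1, ?_⟩
  simpa [hx.2.2 ⟨k, hk⟩] using hc.coord_mem hx.1 ⟨k, hk⟩

theorem mapsTo_stepDown {B : GroupBundle m N π} (hH : IsGroupConnection B H)
    (hc : IsCubeChart p c) (k : ℕ) :
    MapsTo (stepDown π H c k) (stage π c k) (stage π c (k + 1)) := by
  intro x hx
  by_cases hk : k < m
  · have hf := liftFlow_spec hH hc ⟨k, hk⟩ (mem_liftFlowDomain_of_mem_stage hk hx)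
    rw [stepDown, dif_pos hk]
    refine ⟨hx.1, hf.mem_right, fun j => ?_⟩
    rw [hf.coord B hH.toIsConnection hc.1]
    simp only [PiLp.add_apply, PiLp.single_apply, hx.2.2 j]
    rcases lt_trichotomy (j : ℕ) k with h | h | h
    · have hne : j ≠ ⟨k, hk⟩ := fun e => h.ne (congrArg Fin.val e)
      simp [h, hne, h.trans (Nat.lt_succ_self k)]
    · obtain rfl : j = ⟨k, hk⟩ := Fin.ext h
      simp
    · have hne : j ≠ ⟨k, hk⟩ := fun e => h.ne' (congrArg Fin.val e)
      simp [h.not_gt, hne, Nat.not_lt.2 (Nat.succ_le_of_lt h)]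
  · rw [stepDown, dif_neg hk, stage_succ_of_le (not_lt.1 hk)]
    exact hx

theorem mapsTo_stepUp {B : GroupBundle m N π} (hH : IsGroupConnection B H)
    (hc : IsCubeChart p c) (k : ℕ) :
    MapsTo (stepUp π H c k) (stage π c (k + 1)) (stage π c k) := by
  intro x hx
  by_cases hk : k < m
  · have hf := liftFlow_spec hH hc ⟨k, hk⟩ (mem_liftFlowDomain_of_mem_stage_succ hc hk hx)
    rw [stepUp, dif_pos hk]
    refine ⟨hx.1, hf.mem_right, fun j => ?_⟩
    rw [hf.coord B hH.toIsConnection hc.1]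
    simp only [PiLp.add_apply, PiLp.single_apply, hx.2.2 j]
    rcases lt_trichotomy (j : ℕ) k with h | h | h
    · have hne : j ≠ ⟨k, hk⟩ := fun e => h.ne (congrArg Fin.val e)
      simp [h, hne, h.trans (Nat.lt_succ_self k)]
    · obtain rfl : j = ⟨k, hk⟩ := Fin.ext h
      simp
    · have hne : j ≠ ⟨k, hk⟩ := fun e => h.ne' (congrArg Fin.val e)
      simp [h.not_gt, hne, Nat.not_lt.2 (Nat.succ_le_of_lt h)]
  · rw [stepUp, dif_neg hk, ← stage_succ_of_le (not_lt.1 hk)]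
    exact hx

theorem invOn_step {B : GroupBundle m N π} (hH : IsGroupConnection B H)
    (hc : IsCubeChart p c) (k : ℕ) :
    InvOn (stepUp π H c k) (stepDown π H c k) (stage π c k) (stage π c (k + 1)) := by
  by_cases hk : k < m
  · constructor
    · intro x hx
      have hf := liftFlow_spec hH hc ⟨k, hk⟩ (mem_liftFlowDomain_of_mem_stage hk hx)
      have hs := hf.symm
      rw [neg_neg] at hs
      simp only [stepUp, stepDown, dif_pos hk]
      rw [liftFlow_eq hH hc.1 hs]
    · intro x hx
      have hf := liftFlow_spec hH hc ⟨k, hk⟩ (mem_liftFlowDomain_of_mem_stage_succ hc hk hx)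
      simp only [stepUp, stepDown, dif_pos hk]
      rw [liftFlow_eq hH hc.1 hf.symm]
  · constructor <;> intro x _ <;> simp [stepUp, stepDown, hk]

theorem contMDiffOn_step_aux (hc : c ∈ IsManifold.maximalAtlas (𝓡 m) ∞ M) (i : Fin m) (k : ℕ) :
    ContMDiffOn ((𝓡 m).prod (𝓡 N)) 𝓘(ℝ, ℝ) ∞ (fun x : M × G => c x.1 i) (stage π c k) :=
  (EuclideanSpace.proj i : EuclideanSpace ℝ (Fin m) →L[ℝ] ℝ).contMDiff.comp_contMDiffOn
    ((contMDiffOn_of_mem_maximalAtlas hc).comp contMDiff_fst.contMDiffOn fun _ h => h.1)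

theorem contMDiffOn_stepDown {B : GroupBundle m N π} (hH : IsGroupConnection B H)
    (hc : IsCubeChart p c) (k : ℕ) :
    ContMDiffOn ((𝓡 m).prod (𝓡 N)) ((𝓡 m).prod (𝓡 N)) ∞ (stepDown π H c k) (stage π c k) := by
  by_cases hk : k < m
  · have h : ContMDiffOn ((𝓡 m).prod (𝓡 N)) ((𝓡 m).prod (𝓡 N)) ∞
        (fun x : M × G => (x.1, liftFlow π H c ⟨k, hk⟩ (x.2, -(c x.1 ⟨k, hk⟩))))
        (stage π c k) := by
      refine contMDiff_fst.contMDiffOn.prodMk ((contMDiffOn_liftFlow hH hc ⟨k, hk⟩).comp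
        (contMDiff_snd.contMDiffOn.prodMk (contMDiffOn_step_aux hc.1 ⟨k, hk⟩ k).neg) ?_)
      exact fun x hx => mem_liftFlowDomain_of_mem_stage hk hx
    exact h.congr fun x _ => by rw [stepDown, dif_pos hk]
  · exact contMDiffOn_id.congr fun x _ => by rw [stepDown, dif_neg hk, id]

theorem contMDiffOn_stepUp {B : GroupBundle m N π} (hH : IsGroupConnection B H)
    (hc : IsCubeChart p c) (k : ℕ) :
    ContMDiffOn ((𝓡 m).prod (𝓡 N)) ((𝓡 m).prod (𝓡 N)) ∞ (stepUp π H c k)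
      (stage π c (k + 1)) := by
  by_cases hk : k < m
  · have h : ContMDiffOn ((𝓡 m).prod (𝓡 N)) ((𝓡 m).prod (𝓡 N)) ∞
        (fun x : M × G => (x.1, liftFlow π H c ⟨k, hk⟩ (x.2, c x.1 ⟨k, hk⟩)))
        (stage π c (k + 1)) := by
      refine contMDiff_fst.contMDiffOn.prodMk ((contMDiffOn_liftFlow hH hc ⟨k, hk⟩).comp
        (contMDiff_snd.contMDiffOn.prodMk (contMDiffOn_step_aux hc.1 ⟨k, hk⟩ (k + 1))) ?_)
      exact fun x hx => mem_liftFlowDomain_of_mem_stage_succ hc hk hx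
    exact h.congr fun x _ => by rw [stepUp, dif_pos hk]
  · exact contMDiffOn_id.congr fun x _ => by rw [stepUp, dif_neg hk, id]

/-- The base point is carried along as first component because the flow times are its coordinates,
which can no longer be recovered from the second component once they have been moved to zero. -/
theorem iter_spec {B : GroupBundle m N π} (hH : IsGroupConnection B H)
    (hc : IsCubeChart p c) (k : ℕ) :
    MapsTo (iterDown π H c k) (stage π c 0) (stage π c k) ∧
    MapsTo (iterUp π H c k) (stage π c k) (stage π c 0) ∧
    InvOn (iterUp π H c k) (iterDown π H c k) (stage π c 0) (stage π c k) ∧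
    ContMDiffOn ((𝓡 m).prod (𝓡 N)) ((𝓡 m).prod (𝓡 N)) ∞ (iterDown π H c k) (stage π c 0) ∧
    ContMDiffOn ((𝓡 m).prod (𝓡 N)) ((𝓡 m).prod (𝓡 N)) ∞ (iterUp π H c k) (stage π c k) := by
  induction k with
  | zero =>
    exact ⟨mapsTo_id _, mapsTo_id _, ⟨fun _ _ => rfl, fun _ _ => rfl⟩, contMDiffOn_id,
      contMDiffOn_id⟩
  | succ k ih =>
    obtain ⟨h1, h2, h3, h4, h5⟩ := ih
    refine ⟨(mapsTo_stepDown hH hc k).comp h1, h2.comp (mapsTo_stepUp hH hc k), ?_,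
      (contMDiffOn_stepDown hH hc k).comp h4 h1,
      h5.comp (contMDiffOn_stepUp hH hc k) (mapsTo_stepUp hH hc k)⟩
    have hs := invOn_step hH hc k
    constructor
    · intro x hx
      simp only [iterUp, iterDown, Function.comp_apply]
      rw [hs.1 (h1 hx), h3.1 hx]
    · intro x hx
      simp only [iterUp, iterDown, Function.comp_apply]
      rw [h3.2 (mapsTo_stepUp hH hc k hx), hs.2 hx]

theorem iterDown_fst (k : ℕ) (x : M × G) : (iterDown π H c k x).1 = x.1 := by
  induction k with
  | zero => rfl
  | succ k ih =>
    rw [iterDown, Function.comp_apply, stepDown]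
    split_ifs <;> exact ih

theorem mem_stage_zero {g : G} (hg : π g ∈ c.source) : (π g, g) ∈ stage π c 0 :=
  ⟨hg, hg, fun j => by simp⟩

theorem proj_eq_of_mem_stage_zero {x : M × G} (hx : x ∈ stage π c 0) : π x.2 = x.1 := by
  refine c.injOn hx.2.1 hx.1 ?_
  ext j
  simpa using hx.2.2 j

theorem stage_eq (hc : IsCubeChart p c) : stage π c m = c.source ×ˢ (π ⁻¹' {p}) := by
  ext x
  simp only [stage, mem_ofPred_eq, Fin.is_lt, if_true, mem_prod, mem_preimage, mem_singleton_iff]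
  refine and_congr_right fun _ => ⟨fun h => c.injOn h.1 hc.2.1 ?_, fun h => ?_⟩
  · rw [hc.2.2.1]
    ext j
    simpa using h.2 j
  · rw [h, hc.2.2.1]
    exact ⟨hc.2.1, fun j => by simp⟩

theorem proj_iterDown_eq {B : GroupBundle m N π} (hH : IsGroupConnection B H)
    (hc : IsCubeChart p c) (k : ℕ) {g h : G} (hg : π g ∈ c.source) (hgh : π g = π h) :
    π (iterDown π H c k (π g, g)).2 = π (iterDown π H c k (π h, h)).2 := by
  have hh : π h ∈ c.source := hgh ▸ hg
  have h1 := (iter_spec hH hc k).1 (mem_stage_zero hg)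
  have h2 := (iter_spec hH hc k).1 (mem_stage_zero hh)
  refine c.injOn h1.2.1 h2.2.1 ?_
  ext j
  rw [h1.2.2 j, h2.2.2 j, iterDown_fst, iterDown_fst, hgh]

/-- Elements of one fibre flow for the same times through the same fibres, so `LiftFlowsTo.mul`
applies at every step. -/
theorem iterDown_mul {B : GroupBundle m N π} (hH : IsGroupConnection B H)
    (hc : IsCubeChart p c) (k : ℕ) {g h : G} (hg : π g ∈ c.source) (hgh : π g = π h) :
    (iterDown π H c k (π (B.mul g h), B.mul g h)).2 =
      B.mul (iterDown π H c k (π g, g)).2 (iterDown π H c k (π h, h)).2 := by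
  induction k with
  | zero => rfl
  | succ k ih =>
    simp only [iterDown, Function.comp_apply, stepDown]
    split_ifs with hk
    · have hh : π h ∈ c.source := hgh ▸ hg
      have h1 := liftFlow_spec hH hc ⟨k, hk⟩ (mem_liftFlowDomain_of_mem_stage hk
        ((iter_spec hH hc k).1 (mem_stage_zero hg)))
      have h2 := liftFlow_spec hH hc ⟨k, hk⟩ (mem_liftFlowDomain_of_mem_stage hk
        ((iter_spec hH hc k).1 (mem_stage_zero hh)))
      have ht : c (π h) ⟨k, hk⟩ = c (π g) ⟨k, hk⟩ := by rw [hgh]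
      simp only [iterDown_fst] at h1 h2 ⊢
      rw [ht] at h2
      rw [ih, B.proj_mul g h hgh, ht]
      exact liftFlow_eq hH hc.1 (h1.mul hH hc.1 h2 (proj_iterDown_eq hH hc k hg hgh))
    · exact ih

/-- Completeness provides the chain of flows, and uniqueness of flows determines each intermediate
point. -/
theorem cubeFlowsTo_iff {B : GroupBundle m N π} (hH : IsGroupConnection B H)
    (hc : IsCubeChart p c) {g g' : G} (hg : π g ∈ c.source) :
    CubeFlowsTo π H c g g' ↔ g' = (iterDown π H c m (π g, g)).2 := by
  have hstep : ∀ i : Fin m, LiftFlowsTo π H c i (-(c (π g) i)) (iterDown π H c i (π g, g)).2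
      (iterDown π H c (i + 1) (π g, g)).2 := by
    intro i
    have h := liftFlow_spec hH hc i (mem_liftFlowDomain_of_mem_stage i.2
      ((iter_spec hH hc i).1 (mem_stage_zero hg)))
    simp only [iterDown_fst] at h
    simpa only [iterDown, Function.comp_apply, stepDown, dif_pos i.2, iterDown_fst] using h
  constructor
  · rintro ⟨z, hz0, hzm, hz⟩
    have key : ∀ k (hk : k < m + 1), z ⟨k, hk⟩ = (iterDown π H c k (π g, g)).2 := by
      intro k
      induction k with
      | zero => exact fun _ => hz0
      | succ k ih =>
        intro hk
        have h1 := hz ⟨k, Nat.lt_of_succ_lt_succ hk⟩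
        have h2 := hstep ⟨k, Nat.lt_of_succ_lt_succ hk⟩
        rw [Fin.castSucc_mk, ih] at h1
        exact h1.unique (isOpen_preimage_source B)
          (contMDiffOn_horizontalLift B hH.toIsConnection hc.1 _) h2
    rw [← hzm]
    exact key m _
  · rintro rfl
    exact ⟨fun k => (iterDown π H c k (π g, g)).2, rfl, rfl, hstep⟩

theorem isGroupTrivialization_of_isCubeChart {B : GroupBundle m N π} (hH : IsGroupConnection B H)
    (hc : IsCubeChart p c) :
    IsGroupTrivialization B p c.source (fun g => iterDown π H c m (π g, g))
      (fun x => (iterUp π H c m x).2) := by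
  obtain ⟨h1, h2, h3, h4, h5⟩ := iter_spec hH hc m
  rw [stage_eq hc] at h1 h2 h3 h5
  refine ⟨⟨?_, ?_, ⟨?_, ?_⟩, ?_, ?_, ?_⟩, ?_⟩
  · exact fun g hg => h1 (mem_stage_zero hg)
  · intro x hx
    have := h2 hx
    exact this.2.1
  · intro g hg
    change (iterUp π H c m (iterDown π H c m (π g, g))).2 = g
    rw [h3.1 (mem_stage_zero hg)]
  · intro x hx
    -- Points of `stage π c 0` lie on the graph of `π`, so the base point lost in passing to the
    -- second component is recovered.
    have hx0 : (π (iterUp π H c m x).2, (iterUp π H c m x).2) = iterUp π H c m x :=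
      Prod.ext (proj_eq_of_mem_stage_zero (h2 hx)) rfl
    simp only [hx0]
    exact h3.2 hx
  · exact h4.comp (B.smooth_proj.prodMk contMDiff_id).contMDiffOn fun g hg => mem_stage_zero hg
  · exact contMDiff_snd.comp_contMDiffOn h5
  · exact fun g _ => iterDown_fst m _
  · exact fun g h hg hgh => iterDown_mul hH hc m hg hgh

end CubeTrivialization

/-! ### Existence of cube charts -/

/-- The open cube `(-1/2, 1/2)^m`. -/
def openCube (m : ℕ) : Set (EuclideanSpace ℝ (Fin m)) :=
  {v | ∀ i, v i ∈ Ioo (-(1 / 2) : ℝ) (1 / 2)}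

theorem isOpen_openCube (m : ℕ) : IsOpen (openCube m) := by
  simp only [openCube, ofPred_forall]
  exact isOpen_iInter_of_finite fun i =>
    isOpen_Ioo.preimage (by fun_prop : Continuous fun v : EuclideanSpace ℝ (Fin m) => v i)

theorem norm_le_of_mem_openCube {m : ℕ} {v : EuclideanSpace ℝ (Fin m)} (hv : v ∈ openCube m) :
    ‖v‖ ≤ Real.sqrt m := by
  rw [EuclideanSpace.norm_eq]
  refine Real.sqrt_le_sqrt ?_
  calc ∑ i, ‖v i‖ ^ 2 ≤ ∑ _i : Fin m, (1 : ℝ) := by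
        refine Finset.sum_le_sum fun i _ => ?_
        have := hv i
        rw [Real.norm_eq_abs, sq_abs]
        nlinarith [this.1, this.2]
    _ = m := by simp

variable {m : ℕ} {M : Type*} [TopologicalSpace M] [ChartedSpace (EuclideanSpace ℝ (Fin m)) M]
  [IsManifold (𝓡 m) ∞ M]

theorem exists_isCubeChart (x : M) :
    ∃ c : OpenPartialHomeomorph M (EuclideanSpace ℝ (Fin m)), IsCubeChart x c := by
  set E := EuclideanSpace ℝ (Fin m)
  set e := chartAt E x
  obtain ⟨ε, hε, hball⟩ := Metric.isOpen_iff.1 e.open_target (e x) (mem_chart_target E x)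
  -- The cube lies in the closed ball of radius `√m`, so scaling by `r` puts it inside the ball of
  -- radius `ε`. The `+ 1` avoids division by zero when `m = 0`.
  obtain ⟨r, hr, hrε⟩ : ∃ r : ℝ, 0 < r ∧ r * Real.sqrt m < ε :=
    ⟨ε / (Real.sqrt m + 1), by positivity, by
      rw [div_mul_eq_mul_div, div_lt_iff₀ (by positivity)]
      nlinarith [Real.sqrt_nonneg m]⟩
  -- `A` carries the cube to a box around `e x` inside the target of `e`
  let A : E ≃ₜ E := (Homeomorph.smulOfNeZero r hr.ne').trans (Homeomorph.addRight (e x))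
  have hA : ∀ v, A v = r • v + e x := fun v => rfl
  have hAs : ∀ w, A.symm w = r⁻¹ • (w - e x) := by
    intro w
    rw [Homeomorph.symm_apply_eq, hA, smul_inv_smul₀ hr.ne', sub_add_cancel]
  have hAmem : ∀ v ∈ openCube m, A v ∈ e.target := by
    intro v hv
    refine hball ?_
    rw [mem_ball, hA, dist_eq_norm, add_sub_cancel_right, norm_smul, Real.norm_of_nonneg hr.le]
    exact (mul_le_mul_of_nonneg_left (norm_le_of_mem_openCube hv) hr.le).trans_lt hrε
  have hAc : ContDiff ℝ ∞ A := by
    rw [show (A : E → E) = fun v => r • v + e x from funext hA]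
    fun_prop
  have hAsc : ContDiff ℝ ∞ A.symm := by
    rw [show (A.symm : E → E) = fun w => r⁻¹ • (w - e x) from funext hAs]
    fun_prop
  -- The inverse chart is constructed, since restricting its source makes the image of the chart
  -- exactly the cube.
  let c' : OpenPartialHomeomorph E M :=
    (A.toOpenPartialHomeomorph.trans e.symm).restrOpen (openCube m) (isOpen_openCube m)
  have hsource : c'.source = openCube m := by
    ext v
    simp only [c', OpenPartialHomeomorph.restrOpen_source, OpenPartialHomeomorph.trans_source,
      Homeomorph.toOpenPartialHomeomorph_source, OpenPartialHomeomorph.symm_source, univ_inter,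
      mem_inter_iff, mem_preimage]
    exact ⟨fun h => h.2, fun h => ⟨hAmem v h, h⟩⟩
  have h0 : (0 : E) ∈ openCube m := fun i => by simp
  have hc0 : c' 0 = x := by
    change e.symm (A 0) = x
    rw [hA, smul_zero, zero_add]
    exact e.left_inv (mem_chart_source E x)
  have htarget : c'.target ⊆ e.source := by
    intro q hq
    have := c'.map_target hq
    rw [hsource] at this
    have h2 : e.symm (A (c'.symm q)) ∈ e.source := e.map_target (hAmem _ this)
    rwa [show e.symm (A (c'.symm q)) = q from c'.right_inv hq] at h2
  refine ⟨c'.symm, ?_, ?_, ?_, ?_⟩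
  · refine OpenPartialHomeomorph.mem_maximalAtlas_of_contMDiffOn (M := M) c'.symm ?_ ?_
    · exact hAsc.contMDiff.comp_contMDiffOn ((contMDiffOn_chart (I := 𝓡 m)).mono htarget)
    · change ContMDiffOn (𝓡 m) (𝓡 m) ∞ c' c'.source
      rw [hsource]
      exact (contMDiffOn_chart_symm (I := 𝓡 m)).comp hAc.contMDiff.contMDiffOn hAmem
  · change x ∈ c'.target
    rw [← hc0]
    exact c'.map_source (hsource ▸ h0)
  · rw [← hc0]
    exact c'.left_inv (hsource ▸ h0)
  · exact hsource

end GroupBundles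

end

theorem theorem2p4 {m N : ℕ} {M G : Type*}
    [TopologicalSpace M] [T2Space M] [ChartedSpace (EuclideanSpace ℝ (Fin m)) M]
    [IsManifold (𝓡 m) ∞ M]
    [TopologicalSpace G] [T2Space G] [ChartedSpace (EuclideanSpace ℝ (Fin N)) G]
    [IsManifold (𝓡 N) ∞ G]
    (π : G → M) (B : GroupBundles.GroupBundle m N π)
    (H : ∀ g : G, Submodule ℝ (TangentSpace (𝓡 N) g))
    (hH : GroupBundles.IsGroupConnection B H) :
    GroupBundles.IsLocallyTrivial B ∧
    ∀ (p : M) (c : OpenPartialHomeomorph M (EuclideanSpace ℝ (Fin m))),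
      GroupBundles.IsCubeChart p c →
      ∃ (Φ : G → M × G) (Ψ : M × G → G),
        GroupBundles.IsGroupTrivialization B p c.source Φ Ψ ∧
        ∀ g ∈ π ⁻¹' c.source, ∀ g' : G,
          GroupBundles.CubeFlowsTo π H c g g' ↔ g' = (Φ g).2 := by
  refine ⟨fun x => ?_, fun p c hc => ?_⟩
  · obtain ⟨c, hc⟩ := GroupBundles.exists_isCubeChart (m := m) x
    exact ⟨c.source, c.open_source, hc.2.1, _, _,
      GroupBundles.isGroupTrivialization_of_isCubeChart hH hc⟩
  · exact ⟨_, _, GroupBundles.isGroupTrivialization_of_isCubeChart hH hc,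
      fun g hg g' => GroupBundles.cubeFlowsTo_iff hH hc hg⟩
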